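/- There is a universal constant $C>0$ such that the following holds. Let $1\le m\le d$, $\lambda>0$, $\delta\in(0,1)$, $R\ge 0$, and let $D_1,D_2,\dots\subset\mathbb R^d$ be finite non-empty decision sets with $\|x\|\le L$ for all $x\in D_t$ and all $t$; let $w^\star\in\mathbb R^d$ with $\|w^\star\|\le S$. When the action $x_t\in D_t$ is played, the reward $Y_t=x_t^\top w^\star+\eta_t$ is observed, where the noise is conditionally $R$-subgaussian: $\mathbb E[e^{a\eta_t}\mid\eta_1,\dots,\eta_{t-1}]\le e^{a^2R^2/2}$ for all $a\in\mathbb R$ and $t\ge1$. SOFUL (OFUL with a Frequent Directions sketch of size $m$) starts from $S_0=0\in\mathbb R^{m\times d}$. Put $\widetilde V_t=S_t^\top S_t+\lambda I$, $\tilde w_t=\widetilde V_t^{-1}\sum_{s\le t}Y_s x_s$, $\bar\rho_t=\rho_1+\dots+\rho_t$, and $$\tilde\beta_t=R\sqrt{m\ln\Big(1+\frac{tL^2}{m\lambda}\Big)+2\ln\frac1\delta+d\ln\Big(1+\frac{\bar\rho_t}{\lambda}\Big)}\,\sqrt{1+\frac{\bar\rho_t}{\lambda}}+S\sqrt\lambda\Big(1+\frac{\bar\rho_t}{\lambda}\Big).$$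 In round $t$ it plays a maximizer $x_t$ over $x\in D_t$ of $\tilde w_{t-1}^\top x+\tilde\beta_{t-1}\sqrt{x^\top\widetilde V_{t-1}^{-1}x}$, ties being broken as a measurable function of the past, so that $x_t$ is measurable with respect to $\sigma(\eta_1,\dots,\eta_{t-1})$. It then computes an eigendecomposition $S_{t-1}^\top S_{t-1}+x_tx_t^\top=U^\top\mathrm{diag}(r_1,\dots,r_m)U$ with $UU^\top=I_m$ and $r_1\ge\dots\ge r_m\ge0$, and sets $\rho_t=r_m$ and $S_t=\mathrm{diag}(\sqrt{r_1-\rho_t},\dots,\sqrt{r_m-\rho_t})\,U$. For a horizon $T$ let $\lambda_1\ge\dots\ge\lambda_d$ be the eigenvalues of $X_T^\top X_T=\sum_{t\le T}x_tx_t^\top$, and let $$\varepsilon_m=\min_{0\le k<m}\frac{\lambda_{k+1}+\dots+\lambda_d}{\lambda(m-k)},\qquad \widetilde m=m+d\ln(1+\varepsilon_m),$$ $$M_\lambda=\max\{1,L/\sqrt\lambda\},\qquad \Lambda_T=1+\ln\Big(1+\frac{TL^2}{m\lambda}\Big)+\ln\frac1\delta .$$ Then, for every $T$, with probability at least $1-\delta$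 the regret $R_T=\sum_{t=1}^T\big(\max_{x\in D_t}x^\top w^\star-x_t^\top w^\star\big)$ satisfies $$R_T\le C\,M_\lambda\,(1+\varepsilon_m)^{3/2}\,\widetilde m\,(R+S\sqrt\lambda)\,\sqrt T\;\Lambda_T ,$$ and, moreover, if the chosen contexts $x_1,\dots,x_T$ span fewer than $m$ dimensions, then $\varepsilon_m=0$ and $$R_T\le C\,M_\lambda\,m\,(R+S\sqrt\lambda)\,\sqrt T\;\Lambda_T .$$ (Since $M_\lambda\le\max\{1,L\}\max\{1,1/\sqrt\lambda\}$, the bounds also hold with $\max\{1,1/\sqrt\lambda\}$ in place of $M_\lambda$ and $C\max\{1,L\}$ in place of $C$.) -/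

import Mathlib

open MeasureTheory ProbabilityTheory
open scoped Matrix

noncomputable section

namespace SketchedBandit

/-- The space of contexts (actions): `ℝ^d` with the Euclidean norm. -/
abbrev Vec (d : ℕ) : Type := EuclideanSpace ℝ (Fin d)

/-- The norm `‖x‖_A = √(xᵀ A x)`. -/
def wnorm {d : ℕ} (A : Matrix (Fin d) (Fin d) ℝ) (x : Vec d) : ℝ :=
  √(x.ofLp ⬝ᵥ (A *ᵥ x.ofLp))

/-! ### Noise

Rounds are numbered from `0`, so that round `t` comes after exactly `t` earlier rounds. -/

/-- The σ-algebra generated by the noise variables `η s` with `s < t`. -/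
abbrev past {Ω : Type*} (η : ℕ → Ω → ℝ) (t : ℕ) : MeasurableSpace Ω :=
  ⨆ s : Fin t, MeasurableSpace.comap (η s) inferInstance

/-- Conditionally `R`-subgaussian noise: `𝔼[exp (a η_t) | η_s, s < t] ≤ exp (a² R² / 2)` almost
surely, for all `t` and all real `a`; the exponential moments are required to exist. -/
structure IsCondSubgaussian {Ω : Type*} [MeasurableSpace Ω] (P : Measure Ω)
    (η : ℕ → Ω → ℝ) (R : ℝ) : Prop where
  measurable : ∀ t, Measurable (η t)
  integrable_exp : ∀ t (a : ℝ), Integrable (fun ω => Real.exp (a * η t ω)) P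
  condExp_le : ∀ t (a : ℝ),
    P[fun ω => Real.exp (a * η t ω) | past η t] ≤ᵐ[P] fun _ => Real.exp (a ^ 2 * R ^ 2 / 2)

/-! ### Correlation matrix and spectral error -/

/-- The matrix `X_T` whose rows are the first `T` actions. -/
def actionMatrix {d : ℕ} (x : ℕ → Vec d) (T : ℕ) : Matrix (Fin T) (Fin d) ℝ :=
  Matrix.of fun t j => x t j

theorem isHermitian_corr {d : ℕ} (x : ℕ → Vec d) (T : ℕ) :
    ((actionMatrix x T)ᵀ * actionMatrix x T).IsHermitian := by
  have h := Matrix.isHermitian_conjTranspose_mul_self (actionMatrix x T)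
  rwa [Matrix.conjTranspose_eq_transpose_of_trivial] at h

/-- The eigenvalues of the correlation matrix `X_Tᵀ X_T`, with multiplicity, in nonincreasing
order (the index set has `d` elements, numbered from `0`). -/
def corrEigenvalues {d : ℕ} (x : ℕ → Vec d) (T : ℕ) : Fin (Fintype.card (Fin d)) → ℝ :=
  (isHermitian_corr x T).eigenvalues₀

/-- The spectral error: with `λ_1 ≥ … ≥ λ_d` the eigenvalues of `X_Tᵀ X_T`,
`ε_m = min_{0 ≤ k < m} (λ_{k+1} + ⋯ + λ_d) / (λ (m - k))`. -/
def specErr {d : ℕ} (m : ℕ) (lam : ℝ) (x : ℕ → Vec d) (T : ℕ) : ℝ :=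
  ⨅ k : Fin m,
    (∑ i ∈ Finset.univ.filter (fun i : Fin (Fintype.card (Fin d)) => k.val ≤ i.val),
      corrEigenvalues x T i) / (lam * ((m : ℝ) - (k.val : ℝ)))

/-- The effective dimension `m̃ = m + d ln (1 + ε_m)`. -/
def effDim {d : ℕ} (m : ℕ) (lam : ℝ) (x : ℕ → Vec d) (T : ℕ) : ℝ :=
  m + d * Real.log (1 + specErr m lam x T)

/-! ### Frequent Directions -/

/-- One step of Frequent Directions. From an eigendecomposition
`Sᵀ S + x xᵀ = Uᵀ diag(r_1, …, r_m) U`, where `U` is `m × d` with orthonormal rows and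
`r_1 ≥ … ≥ r_m ≥ 0`, the new sketch is `S' = diag(√(r_1 - ρ), …, √(r_m - ρ)) U` with `ρ = r_m`
the smallest of the `r_i`. Any such eigendecomposition may be used. -/
def IsFDStep {m d : ℕ} (S : Matrix (Fin m) (Fin d) ℝ) (x : Vec d) (ρ : ℝ)
    (S' : Matrix (Fin m) (Fin d) ℝ) : Prop :=
  ∃ (U : Matrix (Fin m) (Fin d) ℝ) (r : Fin m → ℝ),
    U * Uᵀ = 1 ∧ Antitone r ∧ (∀ i, 0 ≤ r i) ∧
    Uᵀ * Matrix.diagonal r * U = Sᵀ * S + Matrix.vecMulVec x.ofLp x.ofLp ∧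
    IsLeast (Set.range r) ρ ∧
    S' = Matrix.diagonal (fun i => √(r i - ρ)) * U

/-! ### The algorithm -/

/-- The sketched regularized correlation matrix `Ṽ = Sᵀ S + λ I`. -/
def sketchedV {m d : ℕ} (lam : ℝ) (S : Matrix (Fin m) (Fin d) ℝ) : Matrix (Fin d) (Fin d) ℝ :=
  Sᵀ * S + lam • (1 : Matrix (Fin d) (Fin d) ℝ)

/-- The sketched regularized least squares estimate `w̃_t = Ṽ_t⁻¹ ∑_{s < t} Y_s x_s`. -/
def sketchedRLS {m d : ℕ} (lam : ℝ) (S : Matrix (Fin m) (Fin d) ℝ) (x : ℕ → Vec d) (Y : ℕ → ℝ)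
    (t : ℕ) : Vec d :=
  WithLp.toLp 2 ((sketchedV lam S)⁻¹ *ᵥ (∑ s ∈ Finset.range t, Y s • x s).ofLp)

/-- The confidence radius `β̃_t(δ)`, where `rbar` stands for `ρ̄_t`. -/
def confRadius (d m : ℕ) (lam R S L δ rbar : ℝ) (t : ℕ) : ℝ :=
  R * √(m * Real.log (1 + t * L ^ 2 / (m * lam)) + 2 * Real.log (1 / δ)
        + d * Real.log (1 + rbar / lam)) * √(1 + rbar / lam)
    + S * √lam * (1 + rbar / lam)

/-- The index maximized by the algorithm, `w̃ᵀ y + β ‖y‖_{Ṽ⁻¹}`. -/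
def ucbIndex {d : ℕ} (V : Matrix (Fin d) (Fin d) ℝ) (w : Vec d) (β : ℝ) (y : Vec d) : ℝ :=
  inner ℝ w y + β * wnorm V⁻¹ y

/-- `x` is a sequence of actions that SOFUL, run with regularization `lam`, confidence `δ`, sketch
size `m` and the known constants `R`, `S`, `L`, may choose on the decision sets `D` when the
observed rewards are `Y`. Here `Sk t` is the sketch after `t` rounds, `ρ t` is the eigenvalue
subtracted in round `t`, and `ρ̄_t = ∑_{s < t} ρ s`. Ties in the maximization may be broken
arbitrarily. -/
structure IsSOFULRun {m d : ℕ} (lam δ R S L : ℝ) (D : ℕ → Finset (Vec d)) (Y : ℕ → ℝ)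
    (x : ℕ → Vec d) (Sk : ℕ → Matrix (Fin m) (Fin d) ℝ) (ρ : ℕ → ℝ) : Prop where
  init : Sk 0 = 0
  step : ∀ t, IsFDStep (Sk t) (x t) (ρ t) (Sk (t + 1))
  mem : ∀ t, x t ∈ D t
  maximizes : ∀ t, ∀ y ∈ D t,
    ucbIndex (sketchedV lam (Sk t)) (sketchedRLS lam (Sk t) x Y t)
        (confRadius d m lam R S L δ (∑ s ∈ Finset.range t, ρ s) t) y ≤
      ucbIndex (sketchedV lam (Sk t)) (sketchedRLS lam (Sk t) x Y t)
        (confRadius d m lam R S L δ (∑ s ∈ Finset.range t, ρ s) t) (x t)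

/-! ### Regret -/

/-- The regret `R_T = ∑_{t < T} (max_{y ∈ D_t} yᵀ w⋆ - x_tᵀ w⋆)`. -/
def regret {d : ℕ} (D : ℕ → Finset (Vec d)) (hD : ∀ t, (D t).Nonempty) (w : Vec d)
    (x : ℕ → Vec d) (T : ℕ) : ℝ :=
  ∑ t ∈ Finset.range T, ((D t).sup' (hD t) (fun y => inner ℝ y w) - inner ℝ (x t) w)

/-- The logarithmic factor `1 + ln (1 + T L² / (m λ)) + ln (1 / δ)`. -/
def logFactor (m : ℕ) (lam L δ : ℝ) (T : ℕ) : ℝ :=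
  1 + Real.log (1 + T * L ^ 2 / (m * lam)) + Real.log (1 / δ)

end SketchedBandit

end

/-! Write `G_t` for the correlation matrix of the first `t` actions, `V_t = G_t + λI`, `Ṽ_t` for its
sketched version and `ρ̄_t` for the total shrinkage. A Frequent Directions step removes `ρ UᵀU`,
where `UᵀU` is a projection of trace `m`. Summing over the steps, `SᵀS ⪯ G ⪯ SᵀS + ρ̄ I` and `tr G =
tr SᵀS + m ρ̄` (`frequentDirections_bounds`). Three consequences carry the sketching analysis.
First, `V ⪯ (1 + ρ̄/λ) Ṽ`. Second, testing the trace identity on the top `k` eigenvectors of `G`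
gives `ρ̄/λ ≤ ε_m` (`sum_div_le_specErr`). Third, `ln (det V / λ^d)` is controlled by `m`
logarithmic terms plus `d ln (1 + ρ̄/λ)` (`log_det_regV_le`).

Randomness enters only through the noise sum `N_t = ∑ η_s x_s`. The process `exp (‖N_t‖² / 2R²) /
√(det V_t / λ^d)`, with the norm taken in `V_t⁻¹`, is a supermartingale: its one-step ratio is a
scalar Gaussian mixture of the exponential tilts of `η_t`. A maximal inequality then bounds `N_t`
for all `t < T` simultaneously with probability at least `1 - δ`
(`measure_exists_lt_noise_quad_le`).

On that event the rest is deterministic. The estimation error is `Ṽ⁻¹ (N + z)` with `z = (G - SᵀS) w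
- λ w`, so its `Ṽ`-norm is at most the confidence radius. Optimism bounds each regret term by twice
the radius times `‖x_t‖` in `Ṽ⁻¹`, and Cauchy-Schwarz with the elliptical potential of the
unsketched `V` sums these. The radius costs a factor `1 + ε_m` and the passage from `Ṽ` to `V` costs
`√(1 + ε_m)`, hence the exponent `3/2`. -/

noncomputable section

namespace SketchedBandit

/-! ### Quadratic forms, inverses and determinants of positive matrices. -/

section MatrixFacts

variable {n : Type*} [Fintype n] {A B : Matrix n n ℝ}

theorem dotProduct_mulVec_comm (hA : A.IsHermitian) (x y : n → ℝ) :
    x ⬝ᵥ A *ᵥ y = y ⬝ᵥ A *ᵥ x := by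
  have h : Aᵀ = A := by rw [← Matrix.conjTranspose_eq_transpose_of_trivial]; exact hA
  rw [Matrix.dotProduct_mulVec, ← Matrix.mulVec_transpose, h, dotProduct_comm]

theorem quad_nonneg (hA : A.PosSemidef) (x : n → ℝ) : 0 ≤ x ⬝ᵥ A *ᵥ x := by
  simpa using hA.dotProduct_mulVec_nonneg x

theorem quad_add_smul (hA : A.IsHermitian) (x y : n → ℝ) (c : ℝ) :
    (x + c • y) ⬝ᵥ A *ᵥ (x + c • y) =
      x ⬝ᵥ A *ᵥ x + 2 * c * (x ⬝ᵥ A *ᵥ y) + c ^ 2 * (y ⬝ᵥ A *ᵥ y) := by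
  have := dotProduct_mulVec_comm hA y x
  simp only [Matrix.mulVec_add, Matrix.mulVec_smul, dotProduct_add, add_dotProduct,
    smul_dotProduct, dotProduct_smul, smul_eq_mul]
  rw [this]; ring

/-- Cauchy-Schwarz for a positive semidefinite form. -/
theorem sq_dotProduct_mulVec_le (hA : A.PosSemidef) (x y : n → ℝ) :
    (x ⬝ᵥ A *ᵥ y) ^ 2 ≤ (x ⬝ᵥ A *ᵥ x) * (y ⬝ᵥ A *ᵥ y) := by
  have h := discrim_le_zero (a := y ⬝ᵥ A *ᵥ y) (b := 2 * (x ⬝ᵥ A *ᵥ y)) (c := x ⬝ᵥ A *ᵥ x)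
    (fun c => by
      have := quad_nonneg hA (x + c • y)
      rw [quad_add_smul hA.1] at this
      linarith)
  rw [discrim] at h
  linarith

theorem sqrt_quad_add_le (hA : A.PosSemidef) (x y : n → ℝ) :
    √((x + y) ⬝ᵥ A *ᵥ (x + y)) ≤ √(x ⬝ᵥ A *ᵥ x) + √(y ⬝ᵥ A *ᵥ y) := by
  have h := quad_add_smul hA.1 x y 1
  rw [one_smul] at h
  rw [h]
  have h1 : x ⬝ᵥ A *ᵥ y ≤ √(x ⬝ᵥ A *ᵥ x) * √(y ⬝ᵥ A *ᵥ y) := by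
    rw [← Real.sqrt_mul (quad_nonneg hA x)]
    exact Real.le_sqrt_of_sq_le (sq_dotProduct_mulVec_le hA x y)
  apply Real.sqrt_le_iff.2 ⟨by positivity, ?_⟩
  have h2 := Real.sq_sqrt (quad_nonneg hA x)
  have h3 := Real.sq_sqrt (quad_nonneg hA y)
  nlinarith

variable [DecidableEq n]

theorem mulVec_inv_mulVec (hA : A.PosDef) (x : n → ℝ) : A *ᵥ (A⁻¹ *ᵥ x) = x := by
  rw [Matrix.mulVec_mulVec, Matrix.mul_nonsing_inv _ ((Matrix.isUnit_iff_isUnit_det _).1 hA.isUnit),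
    Matrix.one_mulVec]

theorem inv_mulVec_mulVec (hA : A.PosDef) (x : n → ℝ) : A⁻¹ *ᵥ (A *ᵥ x) = x := by
  rw [Matrix.mulVec_mulVec, Matrix.nonsing_inv_mul _ ((Matrix.isUnit_iff_isUnit_det _).1 hA.isUnit),
    Matrix.one_mulVec]

/-- Inversion reverses the order of quadratic forms. -/
theorem quad_inv_le (hA : A.PosDef) (hB : B.PosDef) {c : ℝ} (hc : 0 < c)
    (h : ∀ x, x ⬝ᵥ A *ᵥ x ≤ c * (x ⬝ᵥ B *ᵥ x)) (y : n → ℝ) :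
    y ⬝ᵥ B⁻¹ *ᵥ y ≤ c * (y ⬝ᵥ A⁻¹ *ᵥ y) := by
  set z := B⁻¹ *ᵥ y with hz
  set v := A⁻¹ *ᵥ y with hv
  have hBz : B *ᵥ z = y := mulVec_inv_mulVec hB y
  have hAv : A *ᵥ v = y := mulVec_inv_mulVec hA y
  -- With `z = B⁻¹ y` and `v = A⁻¹ y`, nonnegativity of the `A`-form at `v - c⁻¹ z` gives the claim:
  -- the cross term is `-2 c⁻¹ (y ⬝ᵥ z)`, and the hypothesis at `z` bounds the square term by `c⁻¹
  -- (y ⬝ᵥ z)`.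
  have h0 := quad_nonneg hA.posSemidef (v + (-c⁻¹) • z)
  rw [quad_add_smul hA.1, dotProduct_mulVec_comm hA.1 v z, hAv, dotProduct_comm v y,
    dotProduct_comm z y] at h0
  have h1 := h z
  rw [hBz, dotProduct_comm z y] at h1
  have h2 : c⁻¹ ^ 2 * (z ⬝ᵥ A *ᵥ z) ≤ c⁻¹ * (y ⬝ᵥ z) := by
    calc c⁻¹ ^ 2 * (z ⬝ᵥ A *ᵥ z) ≤ c⁻¹ ^ 2 * (c * (y ⬝ᵥ z)) := by gcongr
      _ = _ := by field_simp
  have h3 : c⁻¹ * (y ⬝ᵥ z) ≤ y ⬝ᵥ v := by nlinarith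
  rwa [inv_mul_le_iff₀ hc] at h3

theorem one_le_det_one_add (hA : A.PosSemidef) : 1 ≤ (1 + A).det := by
  have hP : (1 + A).PosDef := Matrix.PosDef.one.add_posSemidef hA
  rw [hP.1.det_eq_prod_eigenvalues]
  simp only [RCLike.ofReal_real_eq_id, id]
  refine Finset.one_le_prod fun i _ => ?_
  have h1 := hP.1.mulVec_eigenvectorBasis i
  have h2 : (hP.1.eigenvectorBasis i).ofLp ⬝ᵥ (hP.1.eigenvectorBasis i).ofLp = 1 := by
    have := hP.1.eigenvectorBasis.orthonormal.1 i
    have h3 := real_inner_self_eq_norm_sq (hP.1.eigenvectorBasis i)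
    rw [this, EuclideanSpace.inner_eq_star_dotProduct] at h3
    simpa using h3
  have h3 := quad_nonneg hA (hP.1.eigenvectorBasis i).ofLp
  have h4 := congrArg (fun v => (hP.1.eigenvectorBasis i).ofLp ⬝ᵥ v) h1
  simp only [Matrix.add_mulVec, Matrix.one_mulVec, dotProduct_add, dotProduct_smul, h2,
    smul_eq_mul] at h4
  linarith

/-- Factoring `B - A = Nᴴ N`, the determinant lemma gives `det B = det A * det (1 + N A⁻¹ Nᴴ)`, and
the last factor is at least one. -/
theorem det_le_det (hA : A.PosDef) (hB : (B - A).PosSemidef) : A.det ≤ B.det := by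
  obtain ⟨N, hN⟩ : ∃ N : Matrix n n ℝ, B - A = Nᴴ * N := by
    open scoped MatrixOrder in
    exact CStarAlgebra.nonneg_iff_eq_star_mul_self.1 (Matrix.nonneg_iff_posSemidef.2 hB)
  have hB' : B = A + Nᴴ * N := by rw [← hN]; abel
  have hu := (Matrix.isUnit_iff_isUnit_det _).1 hA.isUnit
  rw [hB', Matrix.det_add_mul _ _ hu]
  have : 1 ≤ (1 + N * A⁻¹ * Nᴴ).det :=
    one_le_det_one_add (hA.inv.posSemidef.mul_mul_conjTranspose_same N)
  exact le_mul_of_one_le_right hA.det_pos.le this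

theorem det_add_vecMulVec (hA : A.PosDef) (x : n → ℝ) :
    (A + Matrix.vecMulVec x x).det = A.det * (1 + x ⬝ᵥ A⁻¹ *ᵥ x) := by
  have hu := (Matrix.isUnit_iff_isUnit_det _).1 hA.isUnit
  have := Matrix.det_add_replicateCol_mul_replicateRow (ι := Unit) hu x x
  rw [← Matrix.vecMulVec_eq] at this
  rw [this, Matrix.det_unique (n := Unit), Matrix.mul_assoc, ← Matrix.replicateCol_mulVec]
  simp [Matrix.mul_apply, dotProduct]

omit [DecidableEq n] in
theorem posSemidef_vecMulVec (x : n → ℝ) : (Matrix.vecMulVec x x).PosSemidef := by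
  simpa using Matrix.posSemidef_vecMulVec_self_star x

/-- The quadratic form of the inverse after a rank-one update. -/
theorem quad_inv_add_vecMulVec (hA : A.PosDef) (s x : n → ℝ) (e : ℝ) :
    (s + e • x) ⬝ᵥ (A + Matrix.vecMulVec x x)⁻¹ *ᵥ (s + e • x) =
      s ⬝ᵥ A⁻¹ *ᵥ s + (2 * e * (x ⬝ᵥ A⁻¹ *ᵥ s) + e ^ 2 * (x ⬝ᵥ A⁻¹ *ᵥ x)
        - (x ⬝ᵥ A⁻¹ *ᵥ s) ^ 2) / (1 + x ⬝ᵥ A⁻¹ *ᵥ x) := by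
  have hA' : (A + Matrix.vecMulVec x x).PosDef := hA.add_posSemidef (posSemidef_vecMulVec x)
  have hq := quad_nonneg hA.inv.posSemidef x
  have hsx := dotProduct_mulVec_comm hA.inv.1 s x
  have e1 := mulVec_inv_mulVec hA s
  have e2 := mulVec_inv_mulVec hA x
  set z := A⁻¹ *ᵥ s
  set y := A⁻¹ *ᵥ x
  have hq' : 1 + x ⬝ᵥ y ≠ 0 := by positivity
  -- The explicit solution supplied by Sherman-Morrison; checking it directly avoids computing the
  -- updated inverse.
  have key : (A + Matrix.vecMulVec x x) *ᵥ (z + ((e - x ⬝ᵥ z) / (1 + x ⬝ᵥ y)) • y) = s + e • x := by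
    simp only [Matrix.mulVec_add, Matrix.add_mulVec, Matrix.mulVec_smul, Matrix.vecMulVec_mulVec,
      e1, e2]
    ext i
    simp
    field_simp
    ring
  rw [← key, inv_mulVec_mulVec hA', key]
  simp only [add_dotProduct, dotProduct_add, smul_dotProduct, dotProduct_smul, smul_eq_mul, hsx]
  field_simp
  ring

/-- AM-GM for the determinant of `1 + A`. -/
theorem log_det_one_add_le [Nonempty n] (hA : A.PosSemidef) :
    Real.log (1 + A).det ≤ Fintype.card n * Real.log (1 + A.trace / Fintype.card n) := by
  have hP : (1 + A).PosDef := Matrix.PosDef.one.add_posSemidef hA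
  have hcard : (0 : ℝ) < Fintype.card n := by exact_mod_cast Fintype.card_pos
  have htr : (1 + A).trace = ∑ i, hP.1.eigenvalues i := by
    simpa using hP.1.trace_eq_sum_eigenvalues
  rw [hP.1.det_eq_prod_eigenvalues]
  simp only [RCLike.ofReal_real_eq_id, id]
  rw [Real.log_prod fun i _ => (hP.eigenvalues_pos i).ne']
  have hj := strictConcaveOn_log_Ioi.concaveOn.le_map_sum (t := Finset.univ)
    (w := fun _ : n => (Fintype.card n : ℝ)⁻¹) (p := hP.1.eigenvalues)
    (fun i _ => by positivity) (by simp [hcard.ne'])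
    (fun i _ => hP.eigenvalues_pos i)
  simp only [smul_eq_mul, ← Finset.mul_sum] at hj
  rw [← htr, Matrix.trace_add, Matrix.trace_one, inv_mul_le_iff₀ hcard] at hj
  have he : (Fintype.card n : ℝ)⁻¹ * (Fintype.card n + A.trace) = 1 + A.trace / Fintype.card n := by
    field_simp
  rwa [he] at hj

end MatrixFacts

/-! ### Deterministic guarantees of the Frequent Directions sketch. -/

section FrequentDirections

/-- The correlation matrix of the first `t` actions, as a sum of rank-one matrices. -/
def gram {d : ℕ} (x : ℕ → Vec d) (t : ℕ) : Matrix (Fin d) (Fin d) ℝ :=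
  ∑ s ∈ Finset.range t, Matrix.vecMulVec (x s).ofLp (x s).ofLp

variable {d m : ℕ} {x : ℕ → Vec d} {lam L : ℝ}

theorem gram_zero : gram x 0 = 0 := by simp [gram]

theorem gram_succ (t : ℕ) :
    gram x (t + 1) = gram x t + Matrix.vecMulVec (x t).ofLp (x t).ofLp := by
  simp [gram, Finset.sum_range_succ]

theorem gram_eq (t : ℕ) : gram x t = (actionMatrix x t)ᵀ * actionMatrix x t := by
  ext i j
  simp [gram, Matrix.sum_apply, Matrix.vecMulVec_apply, Matrix.mul_apply, actionMatrix,
    Finset.sum_range]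

theorem posSemidef_gram (t : ℕ) : (gram x t).PosSemidef :=
  Matrix.posSemidef_sum _ fun _ _ => posSemidef_vecMulVec _

theorem posSemidef_transpose_mul_self (S : Matrix (Fin m) (Fin d) ℝ) : (Sᵀ * S).PosSemidef := by
  simpa using Matrix.posSemidef_conjTranspose_mul_self S

theorem trace_gram_le {t : ℕ} (hx : ∀ s, ‖x s‖ ≤ L) : (gram x t).trace ≤ t * L ^ 2 := by
  rw [gram, Matrix.trace_sum]
  calc _ ≤ ∑ s ∈ Finset.range t, L ^ 2 := by
        refine Finset.sum_le_sum fun s _ => ?_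
        have h : (Matrix.vecMulVec (x s).ofLp (x s).ofLp).trace = ‖x s‖ ^ 2 := by
          rw [EuclideanSpace.real_norm_sq_eq]
          simp [Matrix.trace, Matrix.vecMulVec_apply, sq]
        rw [h]
        exact pow_le_pow_left₀ (norm_nonneg _) (hx s) 2
    _ = _ := by simp

theorem posDef_add_smul_one {A : Matrix (Fin d) (Fin d) ℝ} (hA : A.PosSemidef) (hlam : 0 < lam) :
    (A + lam • (1 : Matrix (Fin d) (Fin d) ℝ)).PosDef :=
  Matrix.PosDef.posSemidef_add hA (Matrix.PosDef.one.smul hlam)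

theorem posDef_sketchedV (hlam : 0 < lam) (S : Matrix (Fin m) (Fin d) ℝ) :
    (sketchedV lam S).PosDef :=
  posDef_add_smul_one (posSemidef_transpose_mul_self S) hlam

theorem posSemidef_one_sub {U : Matrix (Fin m) (Fin d) ℝ} (hU : U * Uᵀ = 1) :
    (1 - Uᵀ * U).PosSemidef := by
  have h : 1 - Uᵀ * U = (1 - Uᵀ * U)ᵀ * (1 - Uᵀ * U) := by
    have h1 : Uᵀ * U * (Uᵀ * U) = Uᵀ * U := by
      rw [Matrix.mul_assoc, ← Matrix.mul_assoc U, hU, Matrix.one_mul]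
    simp only [Matrix.transpose_sub, Matrix.transpose_one, Matrix.transpose_mul,
      Matrix.transpose_transpose, mul_sub, sub_mul, one_mul, mul_one, h1]
    abel
  rw [h]
  exact posSemidef_transpose_mul_self (1 - Uᵀ * U)

theorem IsFDStep.exists_eq {S S' : Matrix (Fin m) (Fin d) ℝ} {y : Vec d} {ρ : ℝ}
    (h : IsFDStep S y ρ S') :
    0 ≤ ρ ∧ ∃ U : Matrix (Fin m) (Fin d) ℝ, U * Uᵀ = 1 ∧
      Sᵀ * S + Matrix.vecMulVec y.ofLp y.ofLp = S'ᵀ * S' + ρ • (Uᵀ * U) := by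
  obtain ⟨U, r, hU, -, hr, hdec, hρ, rfl⟩ := h
  refine ⟨?_, U, hU, ?_⟩
  · obtain ⟨i, rfl⟩ := hρ.1
    exact hr i
  · rw [← hdec]
    have hD : Matrix.diagonal (fun i => √(r i - ρ)) * Matrix.diagonal (fun i => √(r i - ρ))
        = Matrix.diagonal r - ρ • (1 : Matrix (Fin m) (Fin m) ℝ) := by
      rw [Matrix.diagonal_mul_diagonal, Matrix.smul_one_eq_diagonal, Matrix.diagonal_sub]
      congr 1
      ext i
      exact Real.mul_self_sqrt (sub_nonneg.2 (hρ.2 ⟨i, rfl⟩))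
    have hS : (Matrix.diagonal (fun i => √(r i - ρ)) * U)ᵀ * (Matrix.diagonal (fun i => √(r i - ρ)) * U)
        = Uᵀ * (Matrix.diagonal r - ρ • (1 : Matrix (Fin m) (Fin m) ℝ)) * U := by
      rw [← hD, Matrix.transpose_mul, Matrix.diagonal_transpose]
      simp only [Matrix.mul_assoc]
    rw [hS, Matrix.mul_sub, Matrix.sub_mul]
    simp

variable {Sk : ℕ → Matrix (Fin m) (Fin d) ℝ} {ρ : ℕ → ℝ}

theorem sum_nonneg_of_isFDStep (h : ∀ t, IsFDStep (Sk t) (x t) (ρ t) (Sk (t + 1))) (t : ℕ) :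
    0 ≤ ∑ s ∈ Finset.range t, ρ s :=
  Finset.sum_nonneg fun s _ => (h s).exists_eq.1

/-- By `IsFDStep.exists_eq` each step loses exactly `ρ UᵀU`. Since `0 ⪯ UᵀU ⪯ I`, the accumulated
loss lies between `0` and `ρ̄ I`; since `U Uᵀ = 1` has size `m`, its trace is exactly `m ρ̄`. -/
theorem frequentDirections_bounds (h0 : Sk 0 = 0)
    (h : ∀ t, IsFDStep (Sk t) (x t) (ρ t) (Sk (t + 1))) (t : ℕ) :
    (gram x t - (Sk t)ᵀ * Sk t).PosSemidef ∧
    ((Sk t)ᵀ * Sk t + (∑ s ∈ Finset.range t, ρ s) • (1 : Matrix (Fin d) (Fin d) ℝ)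
      - gram x t).PosSemidef ∧
    (gram x t).trace = ((Sk t)ᵀ * Sk t).trace + m * ∑ s ∈ Finset.range t, ρ s := by
  induction t with
  | zero => simp [gram_zero, h0, Matrix.PosSemidef.zero]
  | succ t ih =>
    obtain ⟨ih1, ih2, ih3⟩ := ih
    obtain ⟨hρ, U, hU, he⟩ := (h t).exists_eq
    have hV : Matrix.vecMulVec (x t).ofLp (x t).ofLp =
        (Sk (t + 1))ᵀ * Sk (t + 1) + ρ t • (Uᵀ * U) - (Sk t)ᵀ * Sk t := by
      rw [← he]; abel
    rw [gram_succ, hV, Finset.sum_range_succ]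
    refine ⟨?_, ?_, ?_⟩
    · have := ih1.add ((posSemidef_transpose_mul_self U).smul hρ)
      convert this using 1
      abel
    · have := ih2.add ((posSemidef_one_sub hU).smul hρ)
      convert this using 1
      rw [smul_sub, add_smul]
      abel
    · rw [Matrix.trace_add, Matrix.trace_sub, Matrix.trace_add, ih3, Matrix.trace_smul,
        Matrix.trace_mul_comm Uᵀ U, hU, Matrix.trace_one, Fintype.card_fin, smul_eq_mul]
      ring

end FrequentDirections

/-! ### Shrinkage against the spectral tail. -/

section SpectralError

variable {d m : ℕ} {x : ℕ → Vec d} {lam L : ℝ} {T : ℕ}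

/-- An orthonormal eigenbasis of the correlation matrix, ordered as `corrEigenvalues`. -/
def corrEigenvector (x : ℕ → Vec d) (T : ℕ) (i : Fin (Fintype.card (Fin d))) : Vec d :=
  (isHermitian_corr x T).eigenvectorBasis (Fintype.equivOfCardEq (Fintype.card_fin _) i)

theorem eigenvalues_equiv (i : Fin (Fintype.card (Fin d))) :
    (isHermitian_corr x T).eigenvalues (Fintype.equivOfCardEq (Fintype.card_fin _) i) =
      corrEigenvalues x T i := by
  simp [Matrix.IsHermitian.eigenvalues, corrEigenvalues]

theorem corrEigenvalues_nonneg (i : Fin (Fintype.card (Fin d))) : 0 ≤ corrEigenvalues x T i := by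
  rw [← eigenvalues_equiv]
  have h : ((actionMatrix x T)ᵀ * actionMatrix x T).PosSemidef := by
    rw [← gram_eq]; exact posSemidef_gram T
  exact h.eigenvalues_nonneg _

theorem gram_mulVec_corrEigenvector (i : Fin (Fintype.card (Fin d))) :
    gram x T *ᵥ (corrEigenvector x T i).ofLp
      = corrEigenvalues x T i • (corrEigenvector x T i).ofLp := by
  rw [gram_eq, ← eigenvalues_equiv]
  exact (isHermitian_corr x T).mulVec_eigenvectorBasis _

theorem corrEigenvector_dotProduct_self (i : Fin (Fintype.card (Fin d))) :
    (corrEigenvector x T i).ofLp ⬝ᵥ (corrEigenvector x T i).ofLp = 1 := by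
  have := (isHermitian_corr x T).eigenvectorBasis.orthonormal.1
    (Fintype.equivOfCardEq (Fintype.card_fin _) i)
  have h3 := real_inner_self_eq_norm_sq (corrEigenvector x T i)
  rw [EuclideanSpace.inner_eq_star_dotProduct, corrEigenvector, this, one_pow, star_trivial] at h3
  exact h3

theorem trace_eq_sum_quad (B : Matrix (Fin d) (Fin d) ℝ) :
    B.trace = ∑ i, (corrEigenvector x T i).ofLp ⬝ᵥ B *ᵥ (corrEigenvector x T i).ofLp := by
  set W : Matrix (Fin d) (Fin d) ℝ := ((isHermitian_corr x T).eigenvectorUnitary).1 with hW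
  have hWW : W * star W = 1 := Unitary.coe_mul_star_self _
  have h1 : B.trace = (star W * B * W).trace := by
    rw [Matrix.trace_mul_comm, ← Matrix.mul_assoc, hWW, Matrix.one_mul]
  rw [h1, Matrix.trace, ← Equiv.sum_comp (Fintype.equivOfCardEq (Fintype.card_fin _))]
  refine Finset.sum_congr rfl fun i _ => ?_
  rw [Matrix.diag_apply, Matrix.mul_assoc, Matrix.mul_apply']
  congr 1

theorem trace_gram_eq_sum : (gram x T).trace = ∑ i, corrEigenvalues x T i := by
  rw [trace_eq_sum_quad (x := x) (T := T)]
  refine Finset.sum_congr rfl fun i _ => ?_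
  rw [gram_mulVec_corrEigenvector, dotProduct_smul, corrEigenvector_dotProduct_self, smul_eq_mul,
    mul_one]

theorem specErr_nonneg (hlam : 0 < lam) : 0 ≤ specErr m lam x T := by
  refine Real.iInf_nonneg fun k => div_nonneg
    (Finset.sum_nonneg fun i _ => corrEigenvalues_nonneg i) (mul_nonneg hlam.le ?_)
  have : (k.val : ℝ) ≤ m := by exact_mod_cast k.2.le
  linarith

/-- The sketch retains at least `λ_i - ρ̄` along each of the top `k` eigenvectors, so `tr SᵀS ≥ λ_1
+ ⋯ + λ_k - k ρ̄`. Inserted in `tr G = tr SᵀS + m ρ̄`, this leaves `(m - k) ρ̄ ≤ λ_{k+1} + ⋯ + λ_d`,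
for every `k < m`. -/
theorem sum_div_le_specErr (hm : 1 ≤ m) (hmd : m ≤ d) (hlam : 0 < lam)
    {Sk : ℕ → Matrix (Fin m) (Fin d) ℝ} {ρ : ℕ → ℝ} (h0 : Sk 0 = 0)
    (h : ∀ t, IsFDStep (Sk t) (x t) (ρ t) (Sk (t + 1))) :
    (∑ s ∈ Finset.range T, ρ s) / lam ≤ specErr m lam x T := by
  have : Nonempty (Fin m) := ⟨⟨0, hm⟩⟩
  refine le_ciInf fun k => ?_
  obtain ⟨-, h2, h3⟩ := frequentDirections_bounds h0 h T
  set r := ∑ s ∈ Finset.range T, ρ s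
  have hk : (k.val : ℝ) < m := by exact_mod_cast k.2
  have hsplit := Finset.sum_filter_add_sum_filter_not Finset.univ
    (fun i : Fin (Fintype.card (Fin d)) => k.val ≤ i.val) (corrEigenvalues x T)
  have hcard : (Finset.univ.filter
      (fun i : Fin (Fintype.card (Fin d)) => ¬ k.val ≤ i.val)).card = k.val := by
    have hkd : k.val < Fintype.card (Fin d) := by rw [Fintype.card_fin]; exact k.2.trans_le hmd
    have : Finset.univ.filter (fun i : Fin (Fintype.card (Fin d)) => ¬ k.val ≤ i.val)
        = Finset.Iio ⟨k.val, hkd⟩ := by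
      ext i; simp [Fin.lt_def]
    rw [this, Fin.card_Iio]
  have htr : ∑ i ∈ Finset.univ.filter (fun i : Fin (Fintype.card (Fin d)) => ¬ k.val ≤ i.val),
      (corrEigenvalues x T i - r) ≤ ((Sk T)ᵀ * Sk T).trace := by
    rw [trace_eq_sum_quad (x := x) (T := T)]
    refine le_trans (Finset.sum_le_sum fun i _ => ?_)
      (Finset.sum_le_sum_of_subset_of_nonneg (Finset.filter_subset _ _)
        fun i _ _ => quad_nonneg (posSemidef_transpose_mul_self _) _)
    have := quad_nonneg h2 (corrEigenvector x T i).ofLp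
    rw [Matrix.sub_mulVec, Matrix.add_mulVec, dotProduct_sub, dotProduct_add,
      gram_mulVec_corrEigenvector, Matrix.smul_mulVec, Matrix.one_mulVec, dotProduct_smul,
      dotProduct_smul, corrEigenvector_dotProduct_self, smul_eq_mul, smul_eq_mul] at this
    linarith
  rw [Finset.sum_sub_distrib, Finset.sum_const, hcard, nsmul_eq_mul] at htr
  rw [trace_gram_eq_sum] at h3
  rw [div_le_div_iff₀ hlam (mul_pos hlam (by linarith))]
  nlinarith

/-- The rank of the correlation matrix is the dimension of the span, so fewer than `m` eigenvalues
are nonzero and the tail at `k = m - 1` vanishes. -/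
theorem specErr_eq_zero (hm : 1 ≤ m) (hlam : 0 < lam)
    (hrank : Module.finrank ℝ (Submodule.span ℝ (x '' Set.Iio T)) < m) :
    specErr m lam x T = 0 := by
  refine le_antisymm ?_ (specErr_nonneg hlam)
  have hrk : (gram x T).rank < m := by
    refine lt_of_eq_of_lt ?_ hrank
    rw [gram_eq, Matrix.rank_transpose_mul_self, Matrix.rank_eq_finrank_span_row]
    have hset : Set.range (actionMatrix x T).row
        = (WithLp.linearEquiv 2 ℝ (Fin d → ℝ)) '' (x '' Set.Iio T) := by
      ext v
      constructor
      · rintro ⟨i, rfl⟩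
        exact ⟨x i, ⟨i, i.2, rfl⟩, rfl⟩
      · rintro ⟨_, ⟨i, hi, rfl⟩, rfl⟩
        exact ⟨⟨i, hi⟩, rfl⟩
    rw [hset, ← LinearEquiv.coe_coe, ← Submodule.map_span]
    exact LinearEquiv.finrank_map_eq _ _
  have hz : ∀ i : Fin (Fintype.card (Fin d)), m - 1 ≤ i.val → corrEigenvalues x T i = 0 := by
    intro i hi
    by_contra hne
    have hpos := lt_of_le_of_ne (corrEigenvalues_nonneg i) (Ne.symm hne)
    rw [gram_eq, (isHermitian_corr x T).rank_eq_card_non_zero_eigs] at hrk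
    -- A positive eigenvalue at index `i` makes all `i + 1 ≥ m` eigenvalues up to it positive, which
    -- contradicts the rank bound.
    have hle : Fintype.card (Finset.Iic i) ≤
        Fintype.card {j // (isHermitian_corr x T).eigenvalues j ≠ 0} := by
      refine Fintype.card_le_of_injective
        (fun j => ⟨Fintype.equivOfCardEq (Fintype.card_fin _) j.1, ?_⟩) ?_
      · rw [eigenvalues_equiv]
        exact (hpos.trans_le ((isHermitian_corr x T).eigenvalues₀_antitone
          (Finset.mem_Iic.1 j.2))).ne'
      · intro a b hab
        exact Subtype.ext ((Equiv.injective _) (Subtype.ext_iff.1 hab))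
    rw [Fintype.card_coe, Fin.card_Iic] at hle
    omega
  have hb : BddBelow (Set.range fun k : Fin m =>
      (∑ i ∈ Finset.univ.filter (fun i : Fin (Fintype.card (Fin d)) => k.val ≤ i.val),
        corrEigenvalues x T i) / (lam * ((m : ℝ) - (k.val : ℝ)))) := Set.finite_range _ |>.bddBelow
  refine (ciInf_le hb ⟨m - 1, by omega⟩).trans_eq ?_
  rw [Finset.sum_eq_zero, zero_div]
  intro i hi
  exact hz i (Finset.mem_filter.1 hi).2

end SpectralError

/-! ### Log-determinant of the regularized correlation matrix. -/

section LogDet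

variable {d m : ℕ} {x : ℕ → Vec d} {lam L : ℝ} {Sk : ℕ → Matrix (Fin m) (Fin d) ℝ} {ρ : ℕ → ℝ}

/-- The regularized correlation matrix `V = X^T X + λ I`. -/
def regV (lam : ℝ) (x : ℕ → Vec d) (t : ℕ) : Matrix (Fin d) (Fin d) ℝ :=
  gram x t + lam • (1 : Matrix (Fin d) (Fin d) ℝ)

theorem posDef_regV (hlam : 0 < lam) (t : ℕ) : (regV lam x t).PosDef :=
  posDef_add_smul_one (posSemidef_gram t) hlam

theorem regV_succ (t : ℕ) :
    regV lam x (t + 1) = regV lam x t + Matrix.vecMulVec (x t).ofLp (x t).ofLp := by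
  rw [regV, regV, gram_succ]; abel

theorem posSemidef_smul_sketchedV_sub (hlam : 0 < lam) (h0 : Sk 0 = 0)
    (h : ∀ t, IsFDStep (Sk t) (x t) (ρ t) (Sk (t + 1))) (t : ℕ) :
    ((1 + (∑ s ∈ Finset.range t, ρ s) / lam) • sketchedV lam (Sk t) - regV lam x t).PosSemidef := by
  obtain ⟨-, h2, -⟩ := frequentDirections_bounds h0 h t
  have hr := sum_nonneg_of_isFDStep h t
  have := h2.add ((posSemidef_transpose_mul_self (Sk t)).smul (div_nonneg hr hlam.le))
  convert this using 1
  rw [sketchedV, regV, add_smul, one_smul, smul_add, smul_smul, div_mul_cancel₀ _ hlam.ne']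
  abel

/-- The comparison `V ⪯ (1 + ρ̄/λ) Ṽ` produces the term with factor `d`. Sylvester's identity turns
`det Ṽ` into `λ^d` times a determinant of size `m`, so AM-GM there has factor `m` instead of `d`;
the trace of the sketch is at most that of `G`, hence at most `t L²`. -/
theorem log_det_regV_le (hm : 1 ≤ m) (hlam : 0 < lam) (h0 : Sk 0 = 0)
    (h : ∀ t, IsFDStep (Sk t) (x t) (ρ t) (Sk (t + 1))) (hx : ∀ s, ‖x s‖ ≤ L) (t : ℕ) :
    Real.log ((regV lam x t).det / lam ^ d) ≤
      m * Real.log (1 + t * L ^ 2 / (m * lam))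
        + d * Real.log (1 + (∑ s ∈ Finset.range t, ρ s) / lam) := by
  have : Nonempty (Fin m) := ⟨⟨0, hm⟩⟩
  have hm0 : (0 : ℝ) < m := by exact_mod_cast hm
  obtain ⟨-, -, htr⟩ := frequentDirections_bounds h0 h t
  have hr := sum_nonneg_of_isFDStep h t
  set r := ∑ s ∈ Finset.range t, ρ s
  have hr' : 0 < 1 + r / lam := by positivity
  have hdet := det_le_det (posDef_regV hlam t) (posSemidef_smul_sketchedV_sub hlam h0 h t)
  have hW : ((Sk t) * (Sk t)ᵀ).PosSemidef := by
    simpa using Matrix.posSemidef_self_mul_conjTranspose (Sk t)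
  have hW' : (lam⁻¹ • ((Sk t) * (Sk t)ᵀ)).PosSemidef := hW.smul (inv_nonneg.2 hlam.le)
  have hV : (sketchedV lam (Sk t)).det = lam ^ d * (1 + lam⁻¹ • ((Sk t) * (Sk t)ᵀ)).det := by
    have : sketchedV lam (Sk t) = lam • (1 + (Sk t)ᵀ * (lam⁻¹ • Sk t)) := by
      rw [sketchedV, smul_add, Matrix.mul_smul, smul_smul, mul_inv_cancel₀ hlam.ne', one_smul]
      abel
    rw [this, Matrix.det_smul, Fintype.card_fin, Matrix.det_one_add_mul_comm, Matrix.smul_mul]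
  rw [Matrix.det_smul, Fintype.card_fin, hV] at hdet
  have hD : 1 ≤ (1 + lam⁻¹ • ((Sk t) * (Sk t)ᵀ)).det := one_le_det_one_add hW'
  have hlog := log_det_one_add_le hW'
  rw [Fintype.card_fin, Matrix.trace_smul, Matrix.trace_mul_comm, smul_eq_mul] at hlog
  have hS : ((Sk t)ᵀ * Sk t).trace ≤ t * L ^ 2 := by
    have := trace_gram_le (x := x) (t := t) hx
    have : 0 ≤ (m : ℝ) * r := by positivity
    linarith
  have hS0 : 0 ≤ ((Sk t)ᵀ * Sk t).trace := (posSemidef_transpose_mul_self _).trace_nonneg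
  have hmono : Real.log (1 + lam⁻¹ * ((Sk t)ᵀ * Sk t).trace / m)
      ≤ Real.log (1 + t * L ^ 2 / (m * lam)) := by
    apply Real.log_le_log (by positivity)
    have : t * L ^ 2 / (m * lam) = lam⁻¹ * (t * L ^ 2) / m := by field_simp
    rw [this]
    gcongr
  have hpos : 0 < (regV lam x t).det := (posDef_regV hlam t).det_pos
  calc Real.log ((regV lam x t).det / lam ^ d)
      ≤ Real.log ((1 + r / lam) ^ d * (1 + lam⁻¹ • ((Sk t) * (Sk t)ᵀ)).det) := by
        apply Real.log_le_log (by positivity)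
        rw [div_le_iff₀ (by positivity)]
        linarith
    _ = d * Real.log (1 + r / lam) + Real.log (1 + lam⁻¹ • ((Sk t) * (Sk t)ᵀ)).det := by
        rw [Real.log_mul (by positivity) (by positivity), Real.log_pow]
    _ ≤ _ := by
        have := mul_le_mul_of_nonneg_left hmono hm0.le
        linarith

end LogDet

/-! ### Conditional exponential moments, Gaussian mixtures and a maximal inequality. -/

section ConditionalMoments

open scoped ENNReal NNReal

variable {Ω : Type*} {F mΩ : MeasurableSpace Ω} {P : Measure Ω} [IsProbabilityMeasure P]

/-- A bound on a conditional expectation, tested against nonnegative measurable weights. -/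
theorem lintegral_mul_le_of_condExp_le (hF : F ≤ mΩ) {f : Ω → ℝ} {c : ℝ} (hf0 : 0 ≤ f)
    (hf : Integrable f P) (hc : P[f | F] ≤ᵐ[P] fun _ => c)
    {Z : Ω → ℝ≥0∞} (hZ : Measurable[F] Z) :
    ∫⁻ ω, Z ω * ENNReal.ofReal (f ω) ∂P ≤ ENNReal.ofReal c * ∫⁻ ω, Z ω ∂P := by
  have hfm : AEMeasurable (fun ω => ENNReal.ofReal (f ω)) P :=
    hf.aestronglyMeasurable.aemeasurable.ennreal_ofReal
  -- On `F` the measure with density `f` is dominated by `c P`; integrating an `F`-measurable weight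
  -- only sees these trimmed measures.
  have hle : (P.withDensity fun ω => ENNReal.ofReal (f ω)).trim hF
      ≤ ENNReal.ofReal c • P.trim hF := by
    refine Measure.le_iff.2 fun s hs => ?_
    rw [trim_measurableSet_eq hF hs, withDensity_apply _ (hF s hs), Measure.smul_apply,
      trim_measurableSet_eq hF hs, smul_eq_mul,
      ← ofReal_integral_eq_lintegral_ofReal hf.integrableOn (Filter.Eventually.of_forall hf0),
      ← setIntegral_condExp hF hf hs]
    by_cases hc0 : 0 ≤ c
    · rw [← ENNReal.ofReal_toReal (measure_ne_top P s), ← ENNReal.ofReal_mul hc0]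
      apply ENNReal.ofReal_le_ofReal
      calc ∫ ω in s, (P[f | F]) ω ∂P ≤ ∫ _ in s, c ∂P :=
            setIntegral_mono_ae integrable_condExp.integrableOn (integrable_const c).integrableOn hc
        _ = _ := by rw [setIntegral_const, smul_eq_mul, mul_comm]; rfl
    · rw [ENNReal.ofReal_of_nonpos]
      · exact zero_le
      · refine integral_nonpos_of_ae (ae_restrict_of_ae ?_)
        filter_upwards [hc] with ω hω
        exact hω.trans (not_le.1 hc0).le
  calc ∫⁻ ω, Z ω * ENNReal.ofReal (f ω) ∂P
      = ∫⁻ ω, Z ω ∂(P.withDensity fun ω => ENNReal.ofReal (f ω)) := by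
        rw [lintegral_withDensity_eq_lintegral_mul₀ hfm (hZ.mono hF le_rfl).aemeasurable]
        simp [mul_comm]
    _ = ∫⁻ ω, Z ω ∂((P.withDensity fun ω => ENNReal.ofReal (f ω)).trim hF) :=
        (lintegral_trim hF hZ).symm
    _ ≤ ∫⁻ ω, Z ω ∂(ENNReal.ofReal c • P.trim hF) := lintegral_mono' hle le_rfl
    _ = _ := by rw [lintegral_smul_measure, lintegral_trim hF hZ, smul_eq_mul]

/-- Mixing `v ↦ exp (v e - v² R² / 2)` over a Gaussian `v`. -/
theorem lintegral_gaussianPDFReal_mul_exp (μ e R : ℝ) {s : ℝ} (hs : 0 < s) :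
    ∫⁻ v, ENNReal.ofReal (gaussianPDFReal μ s.toNNReal v * Real.exp (v * e - v ^ 2 * R ^ 2 / 2)) =
      ENNReal.ofReal (Real.exp ((e ^ 2 * s + 2 * e * μ - μ ^ 2 * R ^ 2) / (2 * (1 + s * R ^ 2)))
        / √(1 + s * R ^ 2)) := by
  have h1 : 0 < 1 + s * R ^ 2 := by positivity
  set K := Real.exp ((e ^ 2 * s + 2 * e * μ - μ ^ 2 * R ^ 2) / (2 * (1 + s * R ^ 2)))
        / √(1 + s * R ^ 2) with hK
  have hs' : 0 < s / (1 + s * R ^ 2) := by positivity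
  have key : ∀ v, gaussianPDFReal μ s.toNNReal v * Real.exp (v * e - v ^ 2 * R ^ 2 / 2) =
      K * gaussianPDFReal ((μ + e * s) / (1 + s * R ^ 2)) (s / (1 + s * R ^ 2)).toNNReal v := by
    intro v
    have h2 : √(2 * Real.pi * (s / (1 + s * R ^ 2))) = √(2 * Real.pi * s) / √(1 + s * R ^ 2) := by
      rw [← Real.sqrt_div (by positivity), mul_div_assoc]
    have h3 : 0 < √(2 * Real.pi * s) := by positivity
    have h4 : 0 < √(1 + s * R ^ 2) := by positivity
    -- Completing the square in `v`: the tilted density is a constant times another Gaussian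
    -- density.
    have h5 : -(v - μ) ^ 2 / (2 * s) + (v * e - v ^ 2 * R ^ 2 / 2) =
        (e ^ 2 * s + 2 * e * μ - μ ^ 2 * R ^ 2) / (2 * (1 + s * R ^ 2)) +
          -(v - (μ + e * s) / (1 + s * R ^ 2)) ^ 2 / (2 * (s / (1 + s * R ^ 2))) := by
      field_simp
      ring
    rw [gaussianPDFReal, gaussianPDFReal, Real.coe_toNNReal _ hs.le, Real.coe_toNNReal _ hs'.le, hK,
      mul_assoc, ← Real.exp_add, h5, Real.exp_add, h2]
    field_simp
  simp_rw [key, ENNReal.ofReal_mul (show 0 ≤ K by positivity)]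
  rw [lintegral_const_mul _ (measurable_gaussianPDFReal _ _).ennreal_ofReal,
    lintegral_gaussianPDFReal_eq_one, mul_one]
  simpa using hs'

theorem measurable_uncurry_gaussianPDFReal {α : Type*} {mα : MeasurableSpace α} {b q : α → ℝ}
    (hb : Measurable b) (hq : Measurable q) :
    Measurable (Function.uncurry fun ω v => gaussianPDFReal (b ω) (q ω).toNNReal v) := by
  unfold Function.uncurry gaussianPDFReal
  fun_prop

/-- Exponential tilts of `ξ`, mixed by an `F`-measurable subprobability density with defect
mass on `N`, have conditional mean at most one. -/
theorem lintegral_mul_density_le (hF : F ≤ mΩ) {ξ : Ω → ℝ} {R : ℝ}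
    (hξ : Measurable[mΩ] ξ) (hint : ∀ a : ℝ, Integrable (fun ω => Real.exp (a * ξ ω)) P)
    (hsub : ∀ a : ℝ, P[fun ω => Real.exp (a * ξ ω) | F] ≤ᵐ[P]
      fun _ => Real.exp (a ^ 2 * R ^ 2 / 2))
    {Z : Ω → ℝ≥0∞} (hZ : Measurable[F] Z) {g : Ω → ℝ → ℝ} (hg0 : ∀ ω v, 0 ≤ g ω v)
    (hgv : ∀ v, Measurable[F] fun ω => g ω v) (hg : Measurable (Function.uncurry g))
    {N : Set Ω} (hNF : MeasurableSet[F] N)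
    (hint1 : ∀ ω, N.indicator 1 ω + ∫⁻ v, ENNReal.ofReal (g ω v) = 1) :
    ∫⁻ ω, Z ω * (N.indicator 1 ω +
      ∫⁻ v, ENNReal.ofReal (g ω v * Real.exp (v * ξ ω - v ^ 2 * R ^ 2 / 2))) ∂P
      ≤ ∫⁻ ω, Z ω ∂P := by
  have hZm : Measurable Z := hZ.mono hF le_rfl
  -- For fixed `v` the weight `Z g(·, v)` is `F`-measurable and the tilt has conditional mean at
  -- most one. Tonelli then integrates this bound over `v`.
  have hstep : ∀ v : ℝ, ∫⁻ ω, Z ω * ENNReal.ofReal (g ω v * Real.exp (v * ξ ω - v ^ 2 * R ^ 2 / 2)) ∂P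
      ≤ ∫⁻ ω, Z ω * ENNReal.ofReal (g ω v) ∂P := by
    intro v
    have h := lintegral_mul_le_of_condExp_le hF (fun ω => (Real.exp_pos _).le) (hint v) (hsub v)
      (Z := fun ω => Z ω * ENNReal.ofReal (g ω v)) (hZ.mul (hgv v).ennreal_ofReal)
    calc _ = ∫⁻ ω, ENNReal.ofReal (Real.exp (-(v ^ 2 * R ^ 2 / 2))) *
          (Z ω * ENNReal.ofReal (g ω v) * ENNReal.ofReal (Real.exp (v * ξ ω))) ∂P := by
          refine lintegral_congr fun ω => ?_
          rw [sub_eq_neg_add, Real.exp_add, ENNReal.ofReal_mul (hg0 _ _),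
            ENNReal.ofReal_mul (Real.exp_pos _).le]
          ring
      _ = ENNReal.ofReal (Real.exp (-(v ^ 2 * R ^ 2 / 2))) * ∫⁻ ω,
          (Z ω * ENNReal.ofReal (g ω v) * ENNReal.ofReal (Real.exp (v * ξ ω))) ∂P := by
          rw [lintegral_const_mul' _ _ ENNReal.ofReal_ne_top]
      _ ≤ ENNReal.ofReal (Real.exp (-(v ^ 2 * R ^ 2 / 2))) *
          (ENNReal.ofReal (Real.exp (v ^ 2 * R ^ 2 / 2)) *
            ∫⁻ ω, Z ω * ENNReal.ofReal (g ω v) ∂P) := by gcongr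
      _ = _ := by
          rw [← mul_assoc, ← ENNReal.ofReal_mul (Real.exp_pos _).le, ← Real.exp_add]
          simp
  have hmN : Measurable fun ω => Z ω * N.indicator 1 ω :=
    hZm.mul (measurable_one.indicator (hF _ hNF))
  calc _ = ∫⁻ ω, (Z ω * N.indicator 1 ω + ∫⁻ v, Z ω *
        ENNReal.ofReal (g ω v * Real.exp (v * ξ ω - v ^ 2 * R ^ 2 / 2))) ∂P := by
        refine lintegral_congr fun ω => ?_
        rw [mul_add, lintegral_const_mul]
        have : Measurable (g ω) := hg.comp measurable_prodMk_left
        fun_prop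
    _ = ∫⁻ ω, Z ω * N.indicator 1 ω ∂P + ∫⁻ v, ∫⁻ ω, Z ω *
        ENNReal.ofReal (g ω v * Real.exp (v * ξ ω - v ^ 2 * R ^ 2 / 2)) ∂P := by
        rw [lintegral_add_left hmN, lintegral_lintegral_swap]
        have h1 : Measurable fun p : Ω × ℝ => g p.1 p.2 := hg
        unfold Function.uncurry
        fun_prop
    _ ≤ ∫⁻ ω, Z ω * N.indicator 1 ω ∂P + ∫⁻ v, ∫⁻ ω, Z ω * ENNReal.ofReal (g ω v) ∂P := by
        exact add_le_add le_rfl (lintegral_mono hstep)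
    _ = ∫⁻ ω, (Z ω * N.indicator 1 ω + ∫⁻ v, Z ω * ENNReal.ofReal (g ω v)) ∂P := by
        rw [lintegral_add_left hmN, lintegral_lintegral_swap]
        have h1 : Measurable fun p : Ω × ℝ => g p.1 p.2 := hg
        unfold Function.uncurry
        fun_prop
    _ = ∫⁻ ω, Z ω ∂P := by
        refine lintegral_congr fun ω => ?_
        rw [lintegral_const_mul, ← mul_add, hint1, mul_one]
        have : Measurable (g ω) := hg.comp measurable_prodMk_left
        fun_prop

/-- The one-dimensional method of mixtures, conditionally on `F`. -/
theorem lintegral_mul_mixture_le (hF : F ≤ mΩ) {ξ : Ω → ℝ} {R : ℝ} (hR : 0 < R)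
    (hξ : Measurable[mΩ] ξ) (hint : ∀ a : ℝ, Integrable (fun ω => Real.exp (a * ξ ω)) P)
    (hsub : ∀ a : ℝ, P[fun ω => Real.exp (a * ξ ω) | F] ≤ᵐ[P]
      fun _ => Real.exp (a ^ 2 * R ^ 2 / 2))
    {Z : Ω → ℝ≥0∞} (hZ : Measurable[F] Z) {b q : Ω → ℝ} (hb : Measurable[F] b)
    (hq : Measurable[F] q) (hq0 : ∀ ω, 0 ≤ q ω) (hqb : ∀ ω, q ω = 0 → b ω = 0) :
    ∫⁻ ω, Z ω * ENNReal.ofReal (Real.exp ((2 * ξ ω * b ω + ξ ω ^ 2 * q ω - b ω ^ 2)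
      / (1 + q ω) / (2 * R ^ 2)) / √(1 + q ω)) ∂P ≤ ∫⁻ ω, Z ω ∂P := by
  have hR2 : 0 < R ^ 2 := by positivity
  let g : Ω → ℝ → ℝ := fun ω v => gaussianPDFReal (b ω / R ^ 2) (q ω / R ^ 2).toNNReal v
  have hg0 : ∀ ω v, 0 ≤ g ω v := fun ω v => gaussianPDFReal_nonneg _ _ _
  have hgv : ∀ v, Measurable[F] fun ω => g ω v := fun v =>
    (measurable_uncurry_gaussianPDFReal (mα := F) (hb.div_const _) (hq.div_const _)).comp
      (@measurable_prodMk_right _ _ F _ v)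
  have hg : Measurable (Function.uncurry g) :=
    measurable_uncurry_gaussianPDFReal ((hb.mono hF le_rfl).div_const _)
      ((hq.mono hF le_rfl).div_const _)
  -- At variance zero `gaussianPDFReal` is identically zero. The indicator of `N` restores the
  -- missing unit mass as a point mass at `v = 0`, where the tilt is one; the closed form is also
  -- one there, because `b = 0`.
  let N : Set Ω := {ω | q ω = 0}
  have hNF : MeasurableSet[F] N := hq (measurableSet_singleton 0)
  have hint1 : ∀ ω, N.indicator 1 ω + ∫⁻ v, ENNReal.ofReal (g ω v) = 1 := by
    intro ω
    by_cases h : q ω = 0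
    · have : ∀ v, g ω v = 0 := fun v => by simp [g, h]
      simp [this, N, h]
    · have hs : 0 < q ω / R ^ 2 := div_pos (lt_of_le_of_ne (hq0 ω) (Ne.symm h)) hR2
      have : ∫⁻ v, ENNReal.ofReal (g ω v) = 1 :=
        lintegral_gaussianPDFReal_eq_one _ (by simpa using hs)
      simp [this, N, h]
  have hpt : ∀ ω, ENNReal.ofReal (Real.exp ((2 * ξ ω * b ω + ξ ω ^ 2 * q ω - b ω ^ 2)
      / (1 + q ω) / (2 * R ^ 2)) / √(1 + q ω)) = N.indicator 1 ω +
        ∫⁻ v, ENNReal.ofReal (g ω v * Real.exp (v * ξ ω - v ^ 2 * R ^ 2 / 2)) := by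
    intro ω
    by_cases h : q ω = 0
    · have : ∀ v, g ω v = 0 := fun v => by simp [g, h]
      simp [this, N, h, hqb ω h]
    · have hq1 : 0 < 1 + q ω := by linarith [hq0 ω]
      have hs : 0 < q ω / R ^ 2 := div_pos (lt_of_le_of_ne (hq0 ω) (Ne.symm h)) hR2
      rw [lintegral_gaussianPDFReal_mul_exp _ _ _ hs]
      have hN : N.indicator (1 : Ω → ℝ≥0∞) ω = 0 := by simp [N, h]
      rw [hN, zero_add, div_mul_cancel₀ _ hR2.ne']
      congr 3
      field_simp
      ring
  simp_rw [hpt]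
  exact lintegral_mul_density_le hF hξ hint hsub hZ hg0 hgv hg hNF hint1

omit [IsProbabilityMeasure P] in
/-- The maximal inequality for a nonnegative supermartingale. -/
theorem mul_measure_exists_lt_le_one {ℱ : ℕ → MeasurableSpace Ω} (hℱ : ∀ t, ℱ t ≤ mΩ)
    (hmono : Monotone ℱ) {M : ℕ → Ω → ℝ≥0∞} (hM : ∀ t, Measurable[ℱ t] (M t))
    (h0 : ∫⁻ ω, M 0 ω ∂P ≤ 1)
    (hstep : ∀ t A, MeasurableSet[ℱ t] A → ∫⁻ ω in A, M (t + 1) ω ∂P ≤ ∫⁻ ω in A, M t ω ∂P)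
    (c : ℝ≥0∞) (T : ℕ) : c * P {ω | ∃ t < T, c < M t ω} ≤ 1 := by
  let N : ℕ → Set Ω := fun t => {ω | ∀ s < t, M s ω ≤ c}
  have hN : ∀ t, MeasurableSet[ℱ t] (N t) := by
    intro t
    have : N t = ⋂ s ∈ Finset.range t, {ω | M s ω ≤ c} := by ext; simp [N]
    rw [this]
    refine Finset.measurableSet_biInter _ fun s hs => ?_
    exact hmono (Finset.mem_range.1 hs).le _ (hM s measurableSet_Iic)
  have hsucc : ∀ t, N (t + 1) = N t ∩ {ω | M t ω ≤ c} := by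
    intro t
    ext ω
    simp only [N, Set.mem_ofPred_eq, Set.mem_inter_iff, Nat.lt_succ_iff_lt_or_eq]
    exact ⟨fun h => ⟨fun s hs => h s (.inl hs), h t (.inr rfl)⟩,
      fun h s hs => hs.elim (h.1 s) (fun e => e ▸ h.2)⟩
  -- Stopping at the first exceedance: mass that leaves `N t` carries `M t > c`, so it pays for the
  -- growth of `c * P (N t)ᶜ`.
  have main : ∀ t, ∫⁻ ω in N t, M t ω ∂P + c * P (N t)ᶜ ≤ 1 := by
    intro t
    induction t with
    | zero => simpa [N] using h0
    | succ t ih =>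
      have hB : MeasurableSet {ω | M t ω ≤ c} := hℱ t _ (hM t measurableSet_Iic)
      have hdis : P (N (t + 1))ᶜ ≤ P (N t)ᶜ + P (N t \ {ω | M t ω ≤ c}) := by
        refine (measure_mono ?_).trans (measure_union_le _ _)
        intro ω hω
        rw [hsucc] at hω
        by_cases h : ω ∈ N t
        · exact .inr ⟨h, fun h' => hω ⟨h, h'⟩⟩
        · exact .inl h
      have hcheb : c * P (N t \ {ω | M t ω ≤ c}) ≤ ∫⁻ ω in N t \ {ω | M t ω ≤ c}, M t ω ∂P := by
        rw [← setLIntegral_const]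
        refine setLIntegral_mono' ((hℱ t _ (hN t)).diff hB) fun ω hω => ?_
        exact (not_le.1 hω.2).le
      calc _ ≤ ∫⁻ ω in N t ∩ {ω | M t ω ≤ c}, M t ω ∂P
            + c * (P (N t)ᶜ + P (N t \ {ω | M t ω ≤ c})) := by
            refine add_le_add ?_ (mul_le_mul_right hdis c)
            rw [hsucc]
            exact hstep t _ ((hN t).inter (hM t measurableSet_Iic))
        _ ≤ ∫⁻ ω in N t ∩ {ω | M t ω ≤ c}, M t ω ∂P
            + (c * P (N t)ᶜ + ∫⁻ ω in N t \ {ω | M t ω ≤ c}, M t ω ∂P) := by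
            rw [mul_add]; gcongr
        _ = ∫⁻ ω in N t, M t ω ∂P + c * P (N t)ᶜ := by
            rw [← lintegral_inter_add_sdiff _ (N t) hB]; ring
        _ ≤ 1 := ih
  have hset : {ω | ∃ t < T, c < M t ω} = (N T)ᶜ := by
    ext ω; simp [N]
  rw [hset]
  exact le_add_self.trans (main T)

end ConditionalMoments

/-! ### Measurability of determinants, inverses and quadratic forms. -/

section Measurability

variable {α : Type*} {mα : MeasurableSpace α} {d : ℕ} {A : α → Matrix (Fin d) (Fin d) ℝ}
  {u v : α → Fin d → ℝ}

theorem measurable_det (hA : ∀ i j, Measurable fun a => A a i j) :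
    Measurable fun a => (A a).det := by
  simp_rw [Matrix.det_apply]
  refine Finset.measurable_sum _ fun σ _ => Measurable.const_smul ?_ _
  exact Finset.measurable_prod _ fun i _ => hA _ _

theorem measurable_inv_apply (hA : ∀ i j, Measurable fun a => A a i j) (i j : Fin d) :
    Measurable fun a => (A a)⁻¹ i j := by
  simp_rw [Matrix.inv_def, Ring.inverse_eq_inv', Matrix.smul_apply, smul_eq_mul,
    Matrix.adjugate_apply]
  refine (measurable_det hA).inv.mul (measurable_det fun k l => ?_)
  by_cases h : k = j
  · subst h; simp
  · simpa [Matrix.updateRow_ne h] using hA k l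

theorem measurable_dotProduct_mulVec (hA : ∀ i j, Measurable fun a => A a i j)
    (hu : ∀ i, Measurable fun a => u a i) (hv : ∀ i, Measurable fun a => v a i) :
    Measurable fun a => u a ⬝ᵥ A a *ᵥ v a := by
  simp only [dotProduct, Matrix.mulVec]
  exact Finset.measurable_sum _ fun i _ => (hu i).mul
    (Finset.measurable_sum _ fun j _ => (hA i j).mul (hv j))

theorem measurable_coord (i : Fin d) : Measurable fun v : Vec d => v.ofLp i := by
  have : Continuous fun v : Vec d => v.ofLp i := by fun_prop
  exact this.measurable

end Measurability

/-! ### The self-normalized supermartingale and its tail bound. -/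

section SelfNormalized

variable {Ω : Type*} {mΩ : MeasurableSpace Ω} {P : Measure Ω} [IsProbabilityMeasure P] {d : ℕ}
  {η : ℕ → Ω → ℝ} {x : ℕ → Ω → Vec d} {R lam δ : ℝ}

theorem past_le (hη : ∀ t, Measurable (η t)) (t : ℕ) : past η t ≤ mΩ :=
  iSup_le fun s => (hη s).comap_le

theorem past_mono : Monotone (past η) := fun _ t hst =>
  iSup_le fun r => le_iSup (fun r : Fin t => MeasurableSpace.comap (η r) inferInstance)
    ⟨r, r.2.trans_le hst⟩

theorem measurable_past {s t : ℕ} (h : s < t) : Measurable[past η t] (η s) :=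
  Measurable.of_comap_le (le_iSup (fun r : Fin t => MeasurableSpace.comap (η r) inferInstance)
    ⟨s, h⟩)

/-- The noise-weighted sum of the first `t` actions. -/
def noiseSum (x : ℕ → Vec d) (e : ℕ → ℝ) (t : ℕ) : Fin d → ℝ :=
  ∑ s ∈ Finset.range t, e s • (x s).ofLp

theorem noiseSum_succ (x : ℕ → Vec d) (e : ℕ → ℝ) (t : ℕ) :
    noiseSum x e (t + 1) = noiseSum x e t + e t • (x t).ofLp := by
  simp [noiseSum, Finset.sum_range_succ]

/-- The self-normalized supermartingale. -/
def selfNormalized (lam R : ℝ) (x : ℕ → Vec d) (e : ℕ → ℝ) (t : ℕ) : ℝ :=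
  Real.exp ((noiseSum x e t ⬝ᵥ (regV lam x t)⁻¹ *ᵥ noiseSum x e t) / (2 * R ^ 2)) /
    √((regV lam x t).det / lam ^ d)

theorem selfNormalized_zero (hlam : 0 < lam) (x : ℕ → Vec d) (e : ℕ → ℝ) :
    selfNormalized lam R x e 0 = 1 := by
  simp [selfNormalized, noiseSum, regV, gram_zero, hlam.ne']

/-- The rank-one updates of the inverse and of the determinant isolate a factor depending on the new
noise only through a scalar quadratic, in the form integrated by `lintegral_mul_mixture_le`. -/
theorem selfNormalized_succ (hlam : 0 < lam) (x : ℕ → Vec d) (e : ℕ → ℝ) (t : ℕ) :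
    selfNormalized lam R x e (t + 1) = selfNormalized lam R x e t *
      (Real.exp ((2 * e t * ((x t).ofLp ⬝ᵥ (regV lam x t)⁻¹ *ᵥ noiseSum x e t)
        + e t ^ 2 * ((x t).ofLp ⬝ᵥ (regV lam x t)⁻¹ *ᵥ (x t).ofLp)
        - ((x t).ofLp ⬝ᵥ (regV lam x t)⁻¹ *ᵥ noiseSum x e t) ^ 2)
        / (1 + (x t).ofLp ⬝ᵥ (regV lam x t)⁻¹ *ᵥ (x t).ofLp) / (2 * R ^ 2))
        / √(1 + (x t).ofLp ⬝ᵥ (regV lam x t)⁻¹ *ᵥ (x t).ofLp)) := by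
  have hV := posDef_regV (x := x) hlam t
  rw [selfNormalized, regV_succ, noiseSum_succ, quad_inv_add_vecMulVec hV, det_add_vecMulVec hV,
    add_div, Real.exp_add, mul_div_right_comm,
    mul_div_right_comm (regV lam x t).det, Real.sqrt_mul (by have := hV.det_pos; positivity),
    selfNormalized, div_mul_div_comm, div_mul_eq_mul_div]

theorem measurable_noiseSum (hx : ∀ t, Measurable[past η t] (x t)) (t : ℕ) (i : Fin d) :
    Measurable[past η t] fun ω => noiseSum (fun s => x s ω) (fun s => η s ω) t i := by
  simp only [noiseSum, Finset.sum_apply, Pi.smul_apply, smul_eq_mul]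
  refine Finset.measurable_sum _ fun s hs => ?_
  have hs := Finset.mem_range.1 hs
  refine (measurable_past hs).mul ?_
  exact (measurable_coord i).comp ((hx s).mono (past_mono hs.le) le_rfl)

theorem measurable_regV (hx : ∀ t, Measurable[past η t] (x t)) (t : ℕ) (i j : Fin d) :
    Measurable[past η t] fun ω => regV lam (fun s => x s ω) t i j := by
  simp only [regV, gram, Matrix.add_apply, Matrix.sum_apply, Matrix.vecMulVec_apply]
  refine Measurable.add_const (Finset.measurable_sum _ fun s hs => ?_) _
  have hs := Finset.mem_range.1 hs
  have h : ∀ i : Fin d, Measurable[past η t] fun ω => (x s ω).ofLp i := fun i =>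
    (measurable_coord i).comp ((hx s).mono (past_mono hs.le) le_rfl)
  exact (h i).mul (h j)

theorem measurable_selfNormalized (hx : ∀ t, Measurable[past η t] (x t)) (t : ℕ) :
    Measurable[past η t] fun ω => selfNormalized lam R (fun s => x s ω) (fun s => η s ω) t := by
  have h1 := measurable_dotProduct_mulVec (measurable_inv_apply (measurable_regV (lam := lam) hx t))
    (measurable_noiseSum hx t) (measurable_noiseSum hx t)
  have h2 := measurable_det (measurable_regV (lam := lam) hx t)
  unfold selfNormalized
  exact (Real.measurable_exp.comp (h1.div_const _)).div (h2.div_const _).sqrt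

theorem setLIntegral_selfNormalized_succ_le (hη : IsCondSubgaussian P η R) (hlam : 0 < lam)
    (hR : 0 < R) (hx : ∀ t, Measurable[past η t] (x t)) (t : ℕ) {A : Set Ω}
    (hA : MeasurableSet[past η t] A) :
    ∫⁻ ω in A, ENNReal.ofReal
        (selfNormalized lam R (fun s => x s ω) (fun s => η s ω) (t + 1)) ∂P ≤
      ∫⁻ ω in A, ENNReal.ofReal
        (selfNormalized lam R (fun s => x s ω) (fun s => η s ω) t) ∂P := by
  have hF := past_le hη.measurable t
  have hxt : ∀ i : Fin d, Measurable[past η t] fun ω => (x t ω).ofLp i := fun i =>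
    (measurable_coord i).comp (hx t)
  have hVi := measurable_inv_apply (measurable_regV (lam := lam) hx t)
  have hpos : ∀ ω, (regV lam (fun s => x s ω) t)⁻¹.PosSemidef := fun ω =>
    (posDef_regV hlam t).inv.posSemidef
  have h := lintegral_mul_mixture_le hF hR (hη.measurable t) (hη.integrable_exp t)
    (hη.condExp_le t)
    (Z := A.indicator fun ω => ENNReal.ofReal
        (selfNormalized lam R (fun s => x s ω) (fun s => η s ω) t))
    ((measurable_selfNormalized hx t).ennreal_ofReal.indicator hA)
    (measurable_dotProduct_mulVec hVi hxt (measurable_noiseSum hx t))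
    (measurable_dotProduct_mulVec hVi hxt hxt)
    (fun ω => quad_nonneg (hpos ω) _)
    -- If `x_t` has zero `V⁻¹`-norm, Cauchy-Schwarz makes its pairing with the noise sum vanish too.
    (fun ω h0 => by
      have := sq_dotProduct_mulVec_le (hpos ω) (x t ω).ofLp
        (noiseSum (fun s => x s ω) (fun s => η s ω) t)
      rw [h0, zero_mul] at this
      exact pow_eq_zero_iff two_ne_zero |>.1 (le_antisymm this (sq_nonneg _)))
  rw [lintegral_indicator (hF _ hA)] at h
  refine le_trans (le_of_eq ?_) h
  rw [← lintegral_indicator (hF _ hA)]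
  refine lintegral_congr fun ω => ?_
  by_cases hω : ω ∈ A
  · rw [Set.indicator_of_mem hω, Set.indicator_of_mem hω, selfNormalized_succ hlam,
      ENNReal.ofReal_mul (by unfold selfNormalized; positivity)]
  · simp [hω]

/-- `exp η + exp (-η) - 2` is nonnegative and vanishes only at `η = 0`, while its mean is at most
zero when `R = 0`. -/
theorem ae_eq_zero_of_isCondSubgaussian_zero (hη : IsCondSubgaussian P η 0) :
    ∀ᵐ ω ∂P, ∀ t, η t ω = 0 := by
  refine ae_all_iff.2 fun t => ?_
  have hle : ∀ a : ℝ, ∫ ω, Real.exp (a * η t ω) ∂P ≤ 1 := by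
    intro a
    rw [← integral_condExp (past_le hη.measurable t)]
    calc _ ≤ ∫ _, (1 : ℝ) ∂P := by
          refine integral_mono_ae integrable_condExp (integrable_const _) ?_
          filter_upwards [hη.condExp_le t a] with ω hω
          simpa using hω
      _ = 1 := by simp
  have hnn : 0 ≤ fun ω => Real.exp (1 * η t ω) + Real.exp (-1 * η t ω) - 2 := by
    intro ω
    have h1 := Real.add_one_le_exp (1 * η t ω)
    have h2 := Real.add_one_le_exp (-1 * η t ω)
    simp only [Pi.zero_apply]
    linarith
  have hi := ((hη.integrable_exp t 1).add (hη.integrable_exp t (-1))).sub (integrable_const (2 : ℝ))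
  have hz : ∫ ω, (Real.exp (1 * η t ω) + Real.exp (-1 * η t ω) - 2) ∂P = 0 := by
    refine le_antisymm ?_ (integral_nonneg hnn)
    rw [integral_sub (f := fun ω => Real.exp (1 * η t ω) + Real.exp (-1 * η t ω))
        ((hη.integrable_exp t 1).add (hη.integrable_exp t (-1))) (integrable_const _),
      integral_add (hη.integrable_exp t 1) (hη.integrable_exp t (-1))]
    have := hle 1
    have := hle (-1)
    simp only [integral_const, probReal_univ, one_smul]
    linarith
  rw [integral_eq_zero_iff_of_nonneg hnn hi] at hz
  filter_upwards [hz] with ω hω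
  by_contra hne
  have h1 := Real.add_one_lt_exp (x := 1 * η t ω) (by simpa using hne)
  have h2 := Real.add_one_le_exp (-1 * η t ω)
  simp only [Pi.zero_apply] at hω
  linarith

/-- The self-normalized tail bound for vector-valued martingales, uniformly over `t < T`. -/
theorem measure_exists_lt_noise_quad_le (hη : IsCondSubgaussian P η R) (hlam : 0 < lam)
    (hR : 0 ≤ R) (hδ : 0 < δ) (hx : ∀ t, Measurable[past η t] (x t)) (T : ℕ) :
    P {ω | ∃ t < T, R ^ 2 * (Real.log ((regV lam (fun s => x s ω) t).det / lam ^ d)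
        + 2 * Real.log (1 / δ)) <
      noiseSum (fun s => x s ω) (fun s => η s ω) t ⬝ᵥ (regV lam (fun s => x s ω) t)⁻¹ *ᵥ
        noiseSum (fun s => x s ω) (fun s => η s ω) t} ≤ ENNReal.ofReal δ := by
  -- The supermartingale divides by `R²`, so `R = 0` is separate: the noise vanishes almost surely
  -- and the strict inequality fails.
  rcases hR.eq_or_lt with rfl | hR
  · refine (measure_mono_null ?_ (ae_iff.1 (ae_eq_zero_of_isCondSubgaussian_zero hη))).le.trans
      zero_le
    rintro ω ⟨t, -, ht⟩ h0
    simp [noiseSum, h0] at ht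
  · have hM := mul_measure_exists_lt_le_one (P := P) (past_le hη.measurable) past_mono
      (M := fun t ω => ENNReal.ofReal
        (selfNormalized lam R (fun s => x s ω) (fun s => η s ω) t))
      (fun t => (measurable_selfNormalized hx t).ennreal_ofReal)
      (by simp [selfNormalized_zero hlam])
      (fun t A hA => setLIntegral_selfNormalized_succ_le hη hlam hR hx t hA)
      (ENNReal.ofReal (1 / δ)) T
    have hsub : P {ω | ∃ t < T, R ^ 2 * (Real.log ((regV lam (fun s => x s ω) t).det / lam ^ d)
        + 2 * Real.log (1 / δ)) <
      noiseSum (fun s => x s ω) (fun s => η s ω) t ⬝ᵥ (regV lam (fun s => x s ω) t)⁻¹ *ᵥ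
        noiseSum (fun s => x s ω) (fun s => η s ω) t} ≤ P {ω | ∃ t < T, ENNReal.ofReal (1 / δ) <
          ENNReal.ofReal (selfNormalized lam R (fun s => x s ω) (fun s => η s ω) t)} := by
      refine measure_mono ?_
      rintro ω ⟨t, htT, ht⟩
      refine ⟨t, htT, ?_⟩
      have hD : 0 < (regV lam (fun s => x s ω) t).det / lam ^ d :=
        div_pos (posDef_regV hlam t).det_pos (by positivity)
      have hpos : 0 < selfNormalized lam R (fun s => x s ω) (fun s => η s ω) t := by
        unfold selfNormalized; positivity
      rw [ENNReal.ofReal_lt_ofReal_iff hpos, ← Real.log_lt_log_iff (by positivity) hpos,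
        selfNormalized, Real.log_div (Real.exp_pos _).ne' (by positivity), Real.log_exp,
        Real.log_sqrt hD.le, lt_sub_iff_add_lt, lt_div_iff₀ (by positivity)]
      linarith
    refine hsub.trans ?_
    set p := P {ω | ∃ t < T, ENNReal.ofReal (1 / δ) <
          ENNReal.ofReal (selfNormalized lam R (fun s => x s ω) (fun s => η s ω) t)}
    calc p = ENNReal.ofReal δ * (ENNReal.ofReal (1 / δ) * p) := by
          rw [← mul_assoc, ← ENNReal.ofReal_mul hδ.le, mul_one_div_cancel hδ.ne',
            ENNReal.ofReal_one, one_mul]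
      _ ≤ ENNReal.ofReal δ * 1 := by gcongr
      _ = _ := mul_one _

end SelfNormalized

/-! ### Confidence ellipsoid, optimism and the deterministic regret bound. -/

section Regret

variable {d m : ℕ} {lam δ R S L : ℝ}

theorem abs_dotProduct_le {A : Matrix (Fin d) (Fin d) ℝ} (hA : A.PosDef) (u y : Fin d → ℝ) :
    |u ⬝ᵥ y| ≤ √(u ⬝ᵥ A *ᵥ u) * √(y ⬝ᵥ A⁻¹ *ᵥ y) := by
  have h := sq_dotProduct_mulVec_le hA.posSemidef u (A⁻¹ *ᵥ y)
  rw [mulVec_inv_mulVec hA, dotProduct_comm (A⁻¹ *ᵥ y) y] at h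
  rw [← Real.sqrt_mul (quad_nonneg hA.posSemidef u)]
  exact Real.abs_le_sqrt h

theorem quad_inv_add_smul_one_le {A : Matrix (Fin d) (Fin d) ℝ} (hA : A.PosSemidef)
    (hlam : 0 < lam) (y : Fin d → ℝ) :
    y ⬝ᵥ (A + lam • (1 : Matrix (Fin d) (Fin d) ℝ))⁻¹ *ᵥ y ≤ lam⁻¹ * (y ⬝ᵥ y) := by
  have h := quad_inv_le (A := (1 : Matrix (Fin d) (Fin d) ℝ)) Matrix.PosDef.one
    (posDef_add_smul_one hA hlam) (inv_pos.2 hlam) (fun z => by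
      rw [Matrix.one_mulVec, Matrix.add_mulVec, Matrix.smul_mulVec, Matrix.one_mulVec,
        dotProduct_add, dotProduct_smul, smul_eq_mul, ← div_eq_inv_mul, le_div_iff₀ hlam]
      linarith [quad_nonneg hA z]) y
  simpa using h

/-- If `0 ⪯ E ⪯ r I` then `‖(E - λ I) w‖ ≤ (r + λ) ‖w‖`. -/
theorem dotProduct_self_sub_smul_le {E : Matrix (Fin d) (Fin d) ℝ} {r : ℝ} (hE : E.PosSemidef)
    (hr : 0 ≤ r) (hlam : 0 ≤ lam)
    (hEr : (r • (1 : Matrix (Fin d) (Fin d) ℝ) - E).PosSemidef) (w : Fin d → ℝ) :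
    (E *ᵥ w - lam • w) ⬝ᵥ (E *ᵥ w - lam • w) ≤ (r + lam) ^ 2 * (w ⬝ᵥ w) := by
  have hle : ∀ z, z ⬝ᵥ E *ᵥ z ≤ r * (z ⬝ᵥ z) := by
    intro z
    have := quad_nonneg hEr z
    rw [Matrix.sub_mulVec, Matrix.smul_mulVec, Matrix.one_mulVec, dotProduct_sub,
      dotProduct_smul, smul_eq_mul] at this
    linarith
  have hw := quad_nonneg hE w
  have hww : 0 ≤ w ⬝ᵥ w := by simpa using dotProduct_star_self_nonneg w
  have hcs := sq_dotProduct_mulVec_le hE (E *ᵥ w) w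
  have hEE : 0 ≤ (E *ᵥ w) ⬝ᵥ (E *ᵥ w) := by simpa using dotProduct_star_self_nonneg (E *ᵥ w)
  have h1 : (E *ᵥ w) ⬝ᵥ (E *ᵥ w) ≤ r ^ 2 * (w ⬝ᵥ w) := by
    have h2 := mul_le_mul_of_nonneg_right (hle (E *ᵥ w)) hw
    -- Cauchy-Schwarz in the `E`-form and `E ⪯ r I` give `‖Ew‖⁴ ≤ r ‖Ew‖² (w ⬝ᵥ E w)`; one factor
    -- `‖Ew‖²` cancels unless it is zero.
    have h3 : (E *ᵥ w) ⬝ᵥ (E *ᵥ w) ≤ r * (w ⬝ᵥ E *ᵥ w) := by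
      rcases hEE.eq_or_lt with h0 | h0
      · rw [← h0]; positivity
      · nlinarith
    nlinarith [hle w]
  have hexp : (E *ᵥ w - lam • w) ⬝ᵥ (E *ᵥ w - lam • w) = (E *ᵥ w) ⬝ᵥ (E *ᵥ w)
      - 2 * lam * (w ⬝ᵥ E *ᵥ w) + lam ^ 2 * (w ⬝ᵥ w) := by
    simp only [sub_dotProduct, dotProduct_sub, smul_dotProduct, dotProduct_smul, smul_eq_mul,
      dotProduct_comm (E *ᵥ w) w]
    ring
  rw [hexp]
  have : 0 ≤ lam * (w ⬝ᵥ E *ᵥ w) := by positivity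
  have : 0 ≤ r * lam * (w ⬝ᵥ w) := by positivity
  nlinarith

theorem inner_eq_dotProduct (u v : Vec d) : inner ℝ u v = u.ofLp ⬝ᵥ v.ofLp := by
  rw [EuclideanSpace.inner_eq_star_dotProduct, star_trivial, dotProduct_comm]

theorem sum_smul_eq (x : ℕ → Vec d) (w : Vec d) (e : ℕ → ℝ) (t : ℕ) :
    (∑ s ∈ Finset.range t, ((inner ℝ (x s) w : ℝ) + e s) • x s).ofLp =
      gram x t *ᵥ w.ofLp + noiseSum x e t := by
  induction t with
  | zero => simp [gram_zero, noiseSum]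
  | succ t ih =>
    rw [Finset.sum_range_succ, WithLp.ofLp_add, ih, gram_succ, noiseSum_succ, Matrix.add_mulVec,
      Matrix.vecMulVec_mulVec, WithLp.ofLp_smul, add_smul, inner_eq_dotProduct]
    simp only [op_smul_eq_smul]
    abel

/-- The sketched confidence ellipsoid. -/
theorem wnorm_sketchedRLS_sub_le (hm : 1 ≤ m) (hlam : 0 < lam) (hR : 0 ≤ R)
    {x : ℕ → Vec d} {e : ℕ → ℝ} {w : Vec d} {Sk : ℕ → Matrix (Fin m) (Fin d) ℝ} {ρ : ℕ → ℝ}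
    (hw : ‖w‖ ≤ S) (hx : ∀ s, ‖x s‖ ≤ L) (h0 : Sk 0 = 0)
    (h : ∀ t, IsFDStep (Sk t) (x t) (ρ t) (Sk (t + 1))) {t : ℕ}
    (hgood : noiseSum x e t ⬝ᵥ (regV lam x t)⁻¹ *ᵥ noiseSum x e t ≤
      R ^ 2 * (Real.log ((regV lam x t).det / lam ^ d) + 2 * Real.log (1 / δ))) :
    wnorm (sketchedV lam (Sk t)) (sketchedRLS lam (Sk t) x (fun s => inner ℝ (x s) w + e s) t - w)
      ≤ confRadius d m lam R S L δ (∑ s ∈ Finset.range t, ρ s) t := by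
  obtain ⟨hE, hEr, -⟩ := frequentDirections_bounds h0 h t
  have hr := sum_nonneg_of_isFDStep h t
  have hcmp := posSemidef_smul_sketchedV_sub hlam h0 h t
  have hlog := log_det_regV_le hm hlam h0 h hx t
  set r := ∑ s ∈ Finset.range t, ρ s
  set N := noiseSum x e t with hN
  have hV := posDef_sketchedV hlam (Sk t)
  have hc : 0 < 1 + r / lam := by positivity
  -- The bias of the estimate: sketching error minus regularization.
  set z := (gram x t - (Sk t)ᵀ * Sk t) *ᵥ w.ofLp - lam • w.ofLp with hz
  have hdiff : (sketchedRLS lam (Sk t) x (fun s => inner ℝ (x s) w + e s) t - w).ofLp =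
      (sketchedV lam (Sk t))⁻¹ *ᵥ (N + z) := by
    rw [WithLp.ofLp_sub, sketchedRLS, sum_smul_eq]
    nth_rewrite 2 [← inv_mulVec_mulVec hV w.ofLp]
    rw [← Matrix.mulVec_sub]
    congr 1
    rw [hz, sketchedV, Matrix.add_mulVec, Matrix.sub_mulVec, Matrix.smul_mulVec, Matrix.one_mulVec]
    abel
  have hVz : z ⬝ᵥ (sketchedV lam (Sk t))⁻¹ *ᵥ z ≤ (S * √lam * (1 + r / lam)) ^ 2 := by
    have hS : w.ofLp ⬝ᵥ w.ofLp ≤ S ^ 2 := by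
      rw [← inner_eq_dotProduct, real_inner_self_eq_norm_sq]
      exact pow_le_pow_left₀ (norm_nonneg _) hw 2
    calc _ ≤ lam⁻¹ * (z ⬝ᵥ z) :=
          quad_inv_add_smul_one_le (posSemidef_transpose_mul_self (Sk t)) hlam z
      _ ≤ lam⁻¹ * ((r + lam) ^ 2 * S ^ 2) := by
          gcongr
          refine (dotProduct_self_sub_smul_le hE hr hlam.le ?_ w.ofLp).trans (by gcongr)
          convert hEr using 1
          abel
      _ = _ := by
          rw [mul_pow, mul_pow, Real.sq_sqrt hlam.le]
          field_simp
          ring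
  have hVN : N ⬝ᵥ (sketchedV lam (Sk t))⁻¹ *ᵥ N ≤
      (1 + r / lam) * (R ^ 2 * (m * Real.log (1 + t * L ^ 2 / (m * lam)) + 2 * Real.log (1 / δ)
        + d * Real.log (1 + r / lam))) := by
    refine (quad_inv_le (posDef_regV (x := x) hlam t) hV hc (fun y => ?_) N).trans ?_
    · have := quad_nonneg hcmp y
      rw [Matrix.sub_mulVec, Matrix.smul_mulVec, dotProduct_sub, dotProduct_smul,
        smul_eq_mul] at this
      linarith
    · refine mul_le_mul_of_nonneg_left (hgood.trans ?_) hc.le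
      refine mul_le_mul_of_nonneg_left ?_ (sq_nonneg R)
      linarith
  have hS0 : 0 ≤ S := (norm_nonneg w).trans hw
  rw [wnorm, hdiff, mulVec_inv_mulVec hV, dotProduct_comm]
  refine (sqrt_quad_add_le hV.inv.posSemidef N z).trans ?_
  rw [confRadius]
  refine add_le_add ?_ (Real.sqrt_le_iff.2 ⟨by positivity, hVz⟩)
  refine (Real.sqrt_le_sqrt hVN).trans (le_of_eq ?_)
  rw [Real.sqrt_mul hc.le, Real.sqrt_mul (sq_nonneg R), Real.sqrt_sq hR, mul_comm]

/-- Optimism bounds the instantaneous regret. -/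
theorem sup_sub_inner_le {V : Matrix (Fin d) (Fin d) ℝ} (hV : V.PosDef) {D : Finset (Vec d)}
    (hD : D.Nonempty) {w v x : Vec d} {β : ℝ} (hβ : wnorm V (v - w) ≤ β)
    (hmax : ∀ y ∈ D, ucbIndex V v β y ≤ ucbIndex V v β x) :
    D.sup' hD (fun y => inner ℝ y w) - inner ℝ x w ≤ 2 * β * wnorm V⁻¹ x := by
  -- Every prediction error is within the exploration bonus. Used at `y` and at `x`, this costs two
  -- bonuses, and maximality of the index trades the one at `y` for the one at `x`.
  have hcs : ∀ y : Vec d, |inner ℝ v y - inner ℝ y w| ≤ β * wnorm V⁻¹ y := by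
    intro y
    have h := abs_dotProduct_le hV (v - w).ofLp y.ofLp
    rw [← inner_eq_dotProduct, inner_sub_left, real_inner_comm y w] at h
    exact h.trans (mul_le_mul_of_nonneg_right hβ (Real.sqrt_nonneg _))
  rw [sub_le_iff_le_add]
  refine Finset.sup'_le _ _ fun y hy => ?_
  have h1 := hmax y hy
  have h2 := abs_le.1 (hcs y)
  have h3 := abs_le.1 (hcs x)
  simp only [ucbIndex] at h1
  linarith

theorem le_mul_log_one_add {q M : ℝ} (hq : 0 ≤ q) (hM : 1 ≤ M) (hqM : q ≤ M ^ 2) :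
    q ≤ 2 * M ^ 2 * Real.log (1 + q) := by
  have h1 := Real.one_sub_inv_le_log_of_pos (show 0 < 1 + q by linarith)
  have h2 : 1 - (1 + q)⁻¹ = q / (1 + q) := by field_simp; ring
  rw [h2] at h1
  have h3 : 1 + q ≤ 2 * M ^ 2 := by nlinarith
  calc q = (1 + q) * (q / (1 + q)) := by field_simp
    _ ≤ 2 * M ^ 2 * (q / (1 + q)) := by gcongr
    _ ≤ _ := by gcongr

/-- Each rank-one update multiplies the determinant by `1 + xᵀ V⁻¹ x`, so the logarithms telescope.
-/
theorem sum_log_one_add_quad (hlam : 0 < lam) (x : ℕ → Vec d) (T : ℕ) :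
    ∑ t ∈ Finset.range T, Real.log (1 + (x t).ofLp ⬝ᵥ (regV lam x t)⁻¹ *ᵥ (x t).ofLp) =
      Real.log ((regV lam x T).det / lam ^ d) := by
  induction T with
  | zero => simp [regV, gram_zero, hlam.ne']
  | succ T ih =>
    have hV := posDef_regV (x := x) hlam T
    have hq := quad_nonneg hV.inv.posSemidef (x T).ofLp
    rw [Finset.sum_range_succ, ih, regV_succ, det_add_vecMulVec hV, mul_div_right_comm,
      Real.log_mul (div_pos hV.det_pos (by positivity)).ne' (by positivity)]

/-- The elliptical potential bound. -/
theorem sum_quad_inv_le (hlam : 0 < lam) {x : ℕ → Vec d} (hx : ∀ s, ‖x s‖ ≤ L) (T : ℕ) :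
    ∑ t ∈ Finset.range T, (x t).ofLp ⬝ᵥ (regV lam x t)⁻¹ *ᵥ (x t).ofLp ≤
      2 * max 1 (L / √lam) ^ 2 * Real.log ((regV lam x T).det / lam ^ d) := by
  rw [← sum_log_one_add_quad hlam, Finset.mul_sum]
  refine Finset.sum_le_sum fun t _ => le_mul_log_one_add
    (quad_nonneg (posDef_regV hlam t).inv.posSemidef _) (le_max_left _ _) ?_
  have hL : 0 ≤ L := (norm_nonneg _).trans (hx 0)
  calc _ ≤ lam⁻¹ * ((x t).ofLp ⬝ᵥ (x t).ofLp) :=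
        quad_inv_add_smul_one_le (posSemidef_gram t) hlam _
    _ ≤ lam⁻¹ * L ^ 2 := by
        rw [← inner_eq_dotProduct, real_inner_self_eq_norm_sq]
        have := hx t
        gcongr
    _ = (L / √lam) ^ 2 := by rw [div_pow, Real.sq_sqrt hlam.le]; ring
    _ ≤ _ := by
        have : 0 ≤ L / √lam := by positivity
        gcongr
        exact le_max_right _ _

theorem one_le_logFactor (hlam : 0 < lam) (hδ : 0 < δ) (hδ1 : δ < 1) (T : ℕ) :
    1 ≤ logFactor m lam L δ T := by
  have h1 : 0 ≤ Real.log (1 / δ) := Real.log_nonneg (by rw [le_div_iff₀ hδ]; linarith)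
  have h2 : 0 ≤ Real.log (1 + T * L ^ 2 / (m * lam)) :=
    Real.log_nonneg (le_add_of_nonneg_right (by positivity))
  rw [logFactor]; linarith

/-- All logarithmic terms are absorbed into the single product `m̃ Λ`. The factor two covers `2 ln
(1/δ)`, of which `m̃ Λ` contains at least one copy because `m ≥ 1`. -/
theorem log_terms_le (hm : 1 ≤ m) (hlam : 0 < lam) (hδ : 0 < δ) (hδ1 : δ < 1) {x : ℕ → Vec d}
    {T : ℕ} {r : ℝ} (hr : 0 ≤ r) (hrε : r / lam ≤ specErr m lam x T) {t : ℕ} (htT : t ≤ T) :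
    m * Real.log (1 + t * L ^ 2 / (m * lam)) + 2 * Real.log (1 / δ) + d * Real.log (1 + r / lam)
      ≤ 2 * (effDim m lam x T * logFactor m lam L δ T) ∧
    m * Real.log (1 + t * L ^ 2 / (m * lam)) + d * Real.log (1 + r / lam)
      ≤ effDim m lam x T * logFactor m lam L δ T ∧
    1 ≤ effDim m lam x T * logFactor m lam L δ T := by
  have hm1 : (1 : ℝ) ≤ m := by exact_mod_cast hm
  have hΛ := one_le_logFactor (m := m) (L := L) hlam hδ hδ1 T
  have h1 : 0 ≤ Real.log (1 / δ) := Real.log_nonneg (by rw [le_div_iff₀ hδ]; linarith)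
  have hA0 : 0 ≤ Real.log (1 + t * L ^ 2 / (m * lam)) :=
    Real.log_nonneg (le_add_of_nonneg_right (by positivity))
  have hA : Real.log (1 + t * L ^ 2 / (m * lam)) ≤ Real.log (1 + T * L ^ 2 / (m * lam)) := by
    apply Real.log_le_log (by positivity)
    have : (t : ℝ) ≤ T := by exact_mod_cast htT
    gcongr
  have hB0 : 0 ≤ Real.log (1 + r / lam) :=
    Real.log_nonneg (le_add_of_nonneg_right (by positivity))
  have hB : Real.log (1 + r / lam) ≤ Real.log (1 + specErr m lam x T) := by
    apply Real.log_le_log (by positivity)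
    linarith
  have hdB : d * Real.log (1 + r / lam) ≤ d * Real.log (1 + specErr m lam x T) := by gcongr
  have hdB0 : 0 ≤ d * Real.log (1 + r / lam) := by positivity
  have hmA : m * Real.log (1 + t * L ^ 2 / (m * lam)) ≤
    m * Real.log (1 + T * L ^ 2 / (m * lam)) := by gcongr
  have hmA0 : 0 ≤ m * Real.log (1 + t * L ^ 2 / (m * lam)) := by positivity
  have hprod : m + m * Real.log (1 + T * L ^ 2 / (m * lam)) + m * Real.log (1 / δ)
      + d * Real.log (1 + specErr m lam x T) ≤ effDim m lam x T * logFactor m lam L δ T := by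
    rw [effDim, add_mul]
    refine add_le_add (le_of_eq (by rw [logFactor]; ring)) ?_
    exact le_mul_of_one_le_right (hdB0.trans hdB) hΛ
  have hmδ : Real.log (1 / δ) ≤ m * Real.log (1 / δ) := le_mul_of_one_le_left h1 hm1
  refine ⟨?_, ?_, ?_⟩ <;> linarith

theorem confRadius_le (hm : 1 ≤ m) (hlam : 0 < lam) (hδ : 0 < δ) (hδ1 : δ < 1) (hR : 0 ≤ R)
    (hS : 0 ≤ S) {x : ℕ → Vec d} {T : ℕ} {r : ℝ} (hr : 0 ≤ r)
    (hrε : r / lam ≤ specErr m lam x T) {t : ℕ} (htT : t ≤ T) :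
    confRadius d m lam R S L δ r t ≤ (R + S * √lam) * (1 + specErr m lam x T) *
      √(2 * (effDim m lam x T * logFactor m lam L δ T)) := by
  obtain ⟨h1, -, h3⟩ := log_terms_le (L := L) hm hlam hδ hδ1 hr hrε htT
  set K := effDim m lam x T * logFactor m lam L δ T
  have hr0 : 0 ≤ r / lam := by positivity
  -- The bias term of the radius has no logarithm; `√(2K) ≥ 1` lets it share a common factor with
  -- the noise term.
  have hK : 1 ≤ √(2 * K) := Real.one_le_sqrt.2 (by linarith)
  have hc : √(1 + r / lam) ≤ 1 + specErr m lam x T :=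
    (Real.sqrt_le_iff.2 ⟨by positivity, by nlinarith⟩ : √(1 + r / lam) ≤ 1 + r / lam).trans
      (by linarith)
  have hε : 0 ≤ 1 + specErr m lam x T := by linarith
  rw [confRadius]
  calc _ ≤ R * √(2 * K) * (1 + specErr m lam x T)
        + S * √lam * (1 + specErr m lam x T) * √(2 * K) := by
        refine add_le_add ?_ ?_
        · gcongr
        · refine le_trans ?_ (le_mul_of_one_le_right (by positivity) hK)
          gcongr
    _ = _ := by ring

/-- The constant `4` is the `2` from optimism times the `2` in `√(2K) * √(2K)`: one root comes from
the radius, the other from the elliptical potential. -/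
theorem regret_le_of_noise_quad_le (hm : 1 ≤ m) (hmd : m ≤ d) (hlam : 0 < lam) (hδ : 0 < δ)
    (hδ1 : δ < 1) (hR : 0 ≤ R) {D : ℕ → Finset (Vec d)} (hD : ∀ t, (D t).Nonempty)
    (hL : ∀ t, ∀ y ∈ D t, ‖y‖ ≤ L) {w : Vec d} (hw : ‖w‖ ≤ S) {x : ℕ → Vec d} {e : ℕ → ℝ}
    {Sk : ℕ → Matrix (Fin m) (Fin d) ℝ} {ρ : ℕ → ℝ}
    (hrun : IsSOFULRun lam δ R S L D (fun t => inner ℝ (x t) w + e t) x Sk ρ) {T : ℕ}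
    (hgood : ∀ t < T, noiseSum x e t ⬝ᵥ (regV lam x t)⁻¹ *ᵥ noiseSum x e t ≤
      R ^ 2 * (Real.log ((regV lam x t).det / lam ^ d) + 2 * Real.log (1 / δ))) :
    regret D hD w x T ≤ 4 * max 1 (L / √lam) * (1 + specErr m lam x T) ^ (3 / 2 : ℝ)
      * effDim m lam x T * (R + S * √lam) * √(T : ℝ) * logFactor m lam L δ T := by
  have hS : 0 ≤ S := (norm_nonneg w).trans hw
  have hx : ∀ s, ‖x s‖ ≤ L := fun s => hL s _ (hrun.mem s)
  set ε := specErr m lam x T with hε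
  have hrT := sum_div_le_specErr (T := T) hm hmd hlam hrun.init hrun.step
  have hr0 := sum_nonneg_of_isFDStep hrun.step
  have hrt : ∀ t ≤ T, (∑ s ∈ Finset.range t, ρ s) / lam ≤ ε := fun t ht => by
    refine le_trans ?_ hrT
    gcongr
    exact fun _ _ _ => (hrun.step _).exists_eq.1
  have hε0 : 0 ≤ ε := specErr_nonneg hlam
  obtain ⟨-, hK2, hK1⟩ := log_terms_le (L := L) hm hlam hδ hδ1 (hr0 T) hrT le_rfl
  set K := effDim m lam x T * logFactor m lam L δ T with hK
  have hK0 : 0 ≤ 2 * K := by linarith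
  set M := max 1 (L / √lam) with hM
  have hM0 : 0 ≤ M := zero_le_one.trans (le_max_left _ _)
  set B := (R + S * √lam) * (1 + ε) * √(2 * K) with hB
  have hB0 : 0 ≤ B := by positivity
  have hq : ∑ t ∈ Finset.range T, wnorm (sketchedV lam (Sk t))⁻¹ (x t) ^ 2
      ≤ (1 + ε) * (M ^ 2 * (2 * K)) := by
    -- The potential telescopes for `V` but not for the shrunken `Ṽ`, so the norms are first
    -- compared, at the price `1 + ε`.
    calc _ ≤ ∑ t ∈ Finset.range T,
          (1 + ε) * ((x t).ofLp ⬝ᵥ (regV lam x t)⁻¹ *ᵥ (x t).ofLp) := by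
          refine Finset.sum_le_sum fun t ht => ?_
          have hV := posDef_sketchedV hlam (Sk t)
          rw [wnorm, Real.sq_sqrt (quad_nonneg hV.inv.posSemidef _)]
          refine quad_inv_le (posDef_regV hlam t) hV (by positivity) (fun y => ?_) _
          have h1 := quad_nonneg (posSemidef_smul_sketchedV_sub hlam hrun.init hrun.step t) y
          rw [Matrix.sub_mulVec, Matrix.smul_mulVec, dotProduct_sub, dotProduct_smul,
            smul_eq_mul] at h1
          have h2 := hrt t (Finset.mem_range.1 ht).le
          have h3 := mul_le_mul_of_nonneg_right h2 (quad_nonneg hV.posSemidef y)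
          linarith
      _ ≤ (1 + ε) * (2 * M ^ 2 * Real.log ((regV lam x T).det / lam ^ d)) := by
          rw [← Finset.mul_sum]
          gcongr
          exact sum_quad_inv_le hlam hx T
      _ ≤ (1 + ε) * (2 * M ^ 2 * K) := by
          gcongr
          exact (log_det_regV_le hm hlam hrun.init hrun.step hx T).trans hK2
      _ = _ := by ring
  have hsum : ∑ t ∈ Finset.range T, wnorm (sketchedV lam (Sk t))⁻¹ (x t) ≤
      √T * (√(1 + ε) * (M * √(2 * K))) := by
    have h1 : √T * (√(1 + ε) * (M * √(2 * K))) = √(T * ((1 + ε) * (M ^ 2 * (2 * K)))) := by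
      rw [Real.sqrt_mul (Nat.cast_nonneg T), Real.sqrt_mul (show 0 ≤ 1 + ε by positivity),
        Real.sqrt_mul (sq_nonneg M), Real.sqrt_sq hM0]
    rw [h1]
    refine Real.le_sqrt_of_sq_le (sq_sum_le_card_mul_sum_sq.trans ?_)
    rw [Finset.card_range]
    gcongr
  have hpow : (1 + ε) ^ (3 / 2 : ℝ) = (1 + ε) * √(1 + ε) := by
    rw [Real.sqrt_eq_rpow, ← Real.rpow_one_add' (by positivity) (by norm_num)]
    norm_num
  calc regret D hD w x T
      ≤ ∑ t ∈ Finset.range T, 2 * B * wnorm (sketchedV lam (Sk t))⁻¹ (x t) := by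
        refine Finset.sum_le_sum fun t ht => ?_
        have ht := Finset.mem_range.1 ht
        refine (sup_sub_inner_le (posDef_sketchedV hlam (Sk t)) (hD t)
          (wnorm_sketchedRLS_sub_le hm hlam hR hw hx hrun.init hrun.step (hgood t ht))
          (hrun.maximizes t)).trans ?_
        have := confRadius_le (L := L) hm hlam hδ hδ1 hR hS (hr0 t) (hrt t ht.le) ht.le
        exact mul_le_mul_of_nonneg_right (by linarith) (Real.sqrt_nonneg _)
    _ = 2 * B * ∑ t ∈ Finset.range T, wnorm (sketchedV lam (Sk t))⁻¹ (x t) := by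
        rw [Finset.mul_sum]
    _ ≤ 2 * B * (√T * (√(1 + ε) * (M * √(2 * K)))) := by gcongr
    _ = 2 * (√(2 * K) * √(2 * K)) * M * ((1 + ε) * √(1 + ε)) * (R + S * √lam) * √T := by
        rw [hB]; ring
    _ = _ := by
        rw [Real.mul_self_sqrt hK0, hpow, hK]; ring

end Regret

end SketchedBandit

end

/-! ### Assembly on the good noise event. -/

theorem theorem4 :
    ∃ C : ℝ, 0 < C ∧
      ∀ (d m : ℕ) (lam δ R S L : ℝ) (D : ℕ → Finset (SketchedBandit.Vec d))
        (hD : ∀ t, (D t).Nonempty) (w : SketchedBandit.Vec d)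
        (Ω : Type*) [MeasurableSpace Ω] (P : Measure Ω) [IsProbabilityMeasure P]
        (η : ℕ → Ω → ℝ) (x : ℕ → Ω → SketchedBandit.Vec d)
        (Sk : ℕ → Ω → Matrix (Fin m) (Fin d) ℝ) (ρ : ℕ → Ω → ℝ),
        1 ≤ m → m ≤ d → 0 < lam → 0 < δ → δ < 1 → 0 ≤ R →
        (∀ t, ∀ y ∈ D t, ‖y‖ ≤ L) →
        ‖w‖ ≤ S →
        SketchedBandit.IsCondSubgaussian P η R →
        (∀ t, Measurable[SketchedBandit.past η t] (x t)) →
        (∀ ω, SketchedBandit.IsSOFULRun lam δ R S L D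
          (fun t => inner ℝ (x t ω) w + η t ω) (fun t => x t ω) (fun t => Sk t ω)
          (fun t => ρ t ω)) →
        ∀ T : ℕ,
          P {ω |
              (SketchedBandit.regret D hD w (fun t => x t ω) T ≤
                C * max 1 (L / √lam)
                  * (1 + SketchedBandit.specErr m lam (fun t => x t ω) T) ^ (3 / 2 : ℝ)
                  * SketchedBandit.effDim m lam (fun t => x t ω) T
                  * (R + S * √lam) * √(T : ℝ)
                  * SketchedBandit.logFactor m lam L δ T) ∧
              (Module.finrank ℝ
                  (Submodule.span ℝ ((fun t => x t ω) '' Set.Iio T)) < m →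
                SketchedBandit.specErr m lam (fun t => x t ω) T = 0 ∧
                SketchedBandit.regret D hD w (fun t => x t ω) T ≤
                  C * max 1 (L / √lam) * m * (R + S * √lam) * √(T : ℝ)
                    * SketchedBandit.logFactor m lam L δ T)}ᶜ
            ≤ ENNReal.ofReal δ := by
  refine ⟨4, by norm_num, ?_⟩
  intro d m lam δ R S L D hD w Ω _ P _ η x Sk ρ hm hmd hlam hδ hδ1 hR hL hw hη hx hrun T
  -- The failure set is contained in the noise-deviation event; monotonicity of the outer measure
  -- suffices, so measurability of the failure set is not needed.
  refine (measure_mono ?_).trans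
    (SketchedBandit.measure_exists_lt_noise_quad_le hη hlam hR hδ hx T)
  intro ω hω
  by_contra hgood
  refine hω ?_
  have hreg := SketchedBandit.regret_le_of_noise_quad_le hm hmd hlam hδ hδ1 hR hD hL hw (hrun ω)
    (T := T) (fun t ht => not_lt.1 fun hlt => hgood ⟨t, ht, hlt⟩)
  refine ⟨hreg, fun hrank => ?_⟩
  have hz := SketchedBandit.specErr_eq_zero hm hlam hrank
  refine ⟨hz, ?_⟩
  -- With `ε_m = 0` the effective dimension is `m` and the power equals one.
  rw [SketchedBandit.effDim, hz] at hreg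
  simpa using hreg
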